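/- Let $n\ge 1$ be an integer, write points of $\mathbb{R}^{n+1}$ as $(x,y)=(x_1,\dots,x_n,y)$, and let $$\mathbb{R}^{n+1}_{++}=\{(x_1,\dots,x_n,y)\in\mathbb{R}^{n+1} : x_n>0,\ y>0\}.$$ Let $p$ be a real number with $1\le p\le \frac{n+1}{n-1}$ if $n\ge 2$, and $1\le p<\infty$ if $n=1$. Then there is no function $u\in C^2(\mathbb{R}^{n+1}_{++})\cap C^1(\overline{\mathbb{R}^{n+1}_{++}})$, bounded or unbounded, such that $$\begin{cases}\Delta u=0 & \text{in } \mathbb{R}^{n+1}_{++},\\ u>0 & \text{in } \mathbb{R}^{n+1}_{++},\\ u=0 & \text{on } \{x_n=0,\ y\ge 0\},\\ \dfrac{\partial u}{\partial\nu}=u^p & \text{on } \{x_n>0,\ y=0\},\end{cases}$$ where $\nu=(0,\dots,0,-1)$ is the unit outer normal to $\mathbb{R}^{n+1}_{++}$ on $\{x_n>0,\ y=0\}$. Here $C^1(\overline{\mathbb{R}^{n+1}_{++}})$ means that $u$ and its first-order partial derivatives extend continuously to the closure; no bound on $u$ or its derivatives is required. -/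

import Mathlib

open scoped Laplacian

/-- The index of the coordinate `x_n` of a point `(x_1, …, x_n, y)` of `ℝⁿ⁺¹`, for `n ≥ 1`.
Coordinates are numbered from `0`, so that `x_n` has index `n - 1` and `y` has index `n`. -/
def xIdx (n : ℕ) : Fin (n + 1) := ⟨n - 1, by omega⟩

/-- The index of the coordinate `y` of a point `(x_1, …, x_n, y)` of `ℝⁿ⁺¹`. -/
def yIdx (n : ℕ) : Fin (n + 1) := Fin.last n

/-- The open quarter space `{(x_1, …, x_n, y) : x_n > 0, y > 0}` in `ℝⁿ⁺¹`. -/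
def quarterSpace (n : ℕ) : Set (EuclideanSpace ℝ (Fin (n + 1))) :=
  {z | 0 < z (xIdx n) ∧ 0 < z (yIdx n)}

/-- The unit outer normal `-e_y` to the quarter space on its face `{x_n > 0, y = 0}`. -/
noncomputable def outerNormal (n : ℕ) : EuclideanSpace ℝ (Fin (n + 1)) :=
  -EuclideanSpace.single (yIdx n) (1 : ℝ)

/-- `u` is a classical solution of
`Δu = 0` and `u > 0` in the open quarter space, `u = 0` on `{x_n = 0, y ≥ 0}`,
`∂u/∂ν = u ^ p` on `{x_n > 0, y = 0}`,
that is, one which is `C²` in the open quarter space and `C¹` up to its boundary.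
Values of `u` outside the closed quarter space play no role. -/
structure IsClassicalSolution (n : ℕ) (p : ℝ) (u : EuclideanSpace ℝ (Fin (n + 1)) → ℝ) :
    Prop where
  contDiffOn_two : ContDiffOn ℝ 2 u (quarterSpace n)
  contDiffOn_one : ContDiffOn ℝ 1 u (closure (quarterSpace n))
  harmonic : ∀ z ∈ quarterSpace n, (Δ u) z = 0
  pos : ∀ z ∈ quarterSpace n, 0 < u z
  dirichlet : ∀ z : EuclideanSpace ℝ (Fin (n + 1)),
    z (xIdx n) = 0 → 0 ≤ z (yIdx n) → u z = 0
  neumann : ∀ z : EuclideanSpace ℝ (Fin (n + 1)),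
    0 < z (xIdx n) → z (yIdx n) = 0 →
      fderivWithin ℝ u (closure (quarterSpace n)) z (outerNormal n) = u z ^ p

open Set Filter Topology

/-! The method is that of moving spheres. A solution `v` is compared with its Kelvin transforms in
spheres centred at points `c` with `x_n < 0` and `y = 0`. Since `c` lies outside the quarter space,
the sphere cuts off a bounded cap, empty when the radius is small, and inversion sends the cap into
the quarter space. So the comparison starts for free and never involves the behaviour of `v` at
infinity; this is why no bound is needed.

With weight exponent `m = (n - 1) / 2` the Kelvin transform is harmonic. The hypothesis on `p` reads
`m * p ≤ m + 1`, which is exactly what makes the transform a supersolution of the flux condition on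
`y = 0`. On `x_n = 0` the function `v` vanishes while its transform is nonnegative. A continuity
argument in the radius (`IsQuarterSolution.le_kelvinTransform`) then gives `v ≤` transform in every
cap: strictness comes from the strong maximum principle and a Hopf barrier
(`lt_kelvinTransform_of_le`), and the radius can be increased because a thin shell has a minimum
principle even with a Robin condition of the bad sign (`nonneg_on_thin_quarterShell`).

Sending the centre to infinity flattens the spheres into hyperplanes and yields `v z ≤ v (z + d)`
whenever `d` has positive `x_n`-component and no `y`-component. By continuity `v` is nondecreasing
in `x_n` and depends on `x_n` and `y` only (`le_of_apply_le`).

Monotonicity bounds `v ^ (p - 1)` below by a constant `κ > 0` on the part `x_n ≥ 1` of the flat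
boundary, so the flux of `v` is at least `κ * v` there. On a large enough box this contradicts the
existence of an explicit subsolution (`false_of_monotone`). -/

/-- `φ` is differentiable near `0` and its derivative has derivative `a` at `0`. -/
def HasSecondDerivAtZero (φ : ℝ → ℝ) (a : ℝ) : Prop :=
  ∃ φ' : ℝ → ℝ, (∀ᶠ s in 𝓝 0, HasDerivAt φ (φ' s) s) ∧ HasDerivAt φ' a 0

/-! ### Second derivatives in one variable -/

namespace HasSecondDerivAtZero

variable {φ ψ : ℝ → ℝ} {a b : ℝ}

lemma const (c : ℝ) : HasSecondDerivAtZero (fun _ => c) 0 :=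
  ⟨fun _ => 0, Eventually.of_forall fun s => hasDerivAt_const s c, hasDerivAt_const _ _⟩

lemma add (hφ : HasSecondDerivAtZero φ a) (hψ : HasSecondDerivAtZero ψ b) :
    HasSecondDerivAtZero (fun s => φ s + ψ s) (a + b) := by
  obtain ⟨φ', h1, h2⟩ := hφ
  obtain ⟨ψ', h3, h4⟩ := hψ
  refine ⟨fun s => φ' s + ψ' s, ?_, h2.fun_add h4⟩
  filter_upwards [h1, h3] with s hs hs' using hs.fun_add hs'

lemma const_mul (c : ℝ) (hφ : HasSecondDerivAtZero φ a) :
    HasSecondDerivAtZero (fun s => c * φ s) (c * a) := by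
  obtain ⟨φ', h1, h2⟩ := hφ
  refine ⟨fun s => c * φ' s, ?_, h2.const_mul c⟩
  filter_upwards [h1] with s hs using hs.const_mul c

/-- If `a < 0`, the second derivative test makes `0` a local maximum as well, so `φ` is locally
constant and `a = 0`. -/
lemma nonneg_of_isLocalMin (hφ : HasSecondDerivAtZero φ a) (h : IsLocalMin φ 0) : 0 ≤ a := by
  obtain ⟨φ', h1, h2⟩ := hφ
  by_contra! ha
  have hd : deriv φ =ᶠ[𝓝 0] φ' := h1.mono fun s hs => hs.deriv
  have h0 : deriv φ 0 = 0 := h.deriv_eq_zero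
  have hdd : deriv (deriv φ) 0 = a := by rw [hd.deriv_eq, h2.deriv]
  have hmax : IsLocalMax φ 0 :=
    isLocalMax_of_deriv_deriv_neg (by rw [hdd]; exact ha) h0 h1.self_of_nhds.continuousAt
  have hc : φ =ᶠ[𝓝 0] fun _ => φ 0 := by
    filter_upwards [h, hmax] with s h3 h4 using le_antisymm h4 h3
  have : deriv (deriv φ) 0 = 0 := by
    rw [hc.deriv.deriv_eq]; simp
  linarith

end HasSecondDerivAtZero

lemma tendsto_add_smul_nhds_zero {E : Type*} [NormedAddCommGroup E] [NormedSpace ℝ E] (z e : E) :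
    Tendsto (fun s : ℝ => z + s • e) (𝓝 0) (𝓝 z) := by
  have : Continuous fun s : ℝ => z + s • e := by fun_prop
  simpa using this.tendsto 0

lemma norm_sub_sq_eq_sum {ι : Type*} [Fintype ι] (z c : EuclideanSpace ℝ ι) :
    ‖z - c‖ ^ 2 = ∑ i, (z i - c i) ^ 2 := by
  simp [EuclideanSpace.norm_sq_eq]

/-- The second derivatives of `f` at `z` along the coordinate lines exist and have sum `L`. -/
def HasLaplacianAt {ι : Type*} [Fintype ι] [DecidableEq ι] (f : EuclideanSpace ℝ ι → ℝ) (L : ℝ)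
    (z : EuclideanSpace ℝ ι) : Prop :=
  ∃ a : ι → ℝ, (∀ i, HasSecondDerivAtZero
    (fun s : ℝ => f (z + s • EuclideanSpace.single i (1 : ℝ))) (a i)) ∧ ∑ i, a i = L

/-! ### Laplacians computed along coordinate lines -/

section Lines

variable {ι : Type*} [Fintype ι] [DecidableEq ι]

namespace HasLaplacianAt

variable {f g : EuclideanSpace ℝ ι → ℝ} {a b : ℝ} {z : EuclideanSpace ℝ ι}

lemma add (hf : HasLaplacianAt f a z) (hg : HasLaplacianAt g b z) :
    HasLaplacianAt (fun x => f x + g x) (a + b) z := by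
  obtain ⟨α, h1, rfl⟩ := hf
  obtain ⟨β, h2, rfl⟩ := hg
  exact ⟨fun i => α i + β i, fun i => (h1 i).add (h2 i), Finset.sum_add_distrib⟩

lemma const_mul (c : ℝ) (hf : HasLaplacianAt f a z) :
    HasLaplacianAt (fun x => c * f x) (c * a) z := by
  obtain ⟨α, h1, rfl⟩ := hf
  exact ⟨fun i => c * α i, fun i => (h1 i).const_mul c, (Finset.mul_sum _ _ _).symm⟩

lemma nonneg_of_isLocalMin (hf : HasLaplacianAt f a z) (h : IsLocalMin f z) : 0 ≤ a := by
  obtain ⟨α, h1, rfl⟩ := hf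
  refine Finset.sum_nonneg fun i _ => (h1 i).nonneg_of_isLocalMin ?_
  have := (tendsto_add_smul_nhds_zero z (EuclideanSpace.single i (1 : ℝ))).eventually h
  simpa [IsLocalMin, IsMinFilter] using this

end HasLaplacianAt

lemma ContDiffAt.hasLaplacianAt {f : EuclideanSpace ℝ ι → ℝ} {z : EuclideanSpace ℝ ι}
    (hf : ContDiffAt ℝ 2 f z) : HasLaplacianAt f ((Δ f) z) z := by
  refine ⟨fun i => fderiv ℝ (fderiv ℝ f) z (EuclideanSpace.single i 1)
    (EuclideanSpace.single i 1), fun i => ?_, ?_⟩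
  · set e : EuclideanSpace ℝ ι := EuclideanSpace.single i 1
    have hline : ∀ s : ℝ, HasDerivAt (fun s : ℝ => z + s • e) e s := fun s => by
      simpa using ((hasDerivAt_id s).smul_const e).const_add z
    refine ⟨fun s => fderiv ℝ f (z + s • e) e, ?_, ?_⟩
    · have h1 : ∀ᶠ x in 𝓝 z, DifferentiableAt ℝ f x := by
        filter_upwards [hf.eventually (by simp)] with x hx using hx.differentiableAt (by simp)
      filter_upwards [(tendsto_add_smul_nhds_zero z e).eventually h1] with s hs
      exact hs.hasFDerivAt.comp_hasDerivAt s (hline s)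
    · have h2 : DifferentiableAt ℝ (fderiv ℝ f) z :=
        (hf.fderiv_right (m := 1) (by norm_num)).differentiableAt (by simp)
      have h3 : HasFDerivAt (fderiv ℝ f) (fderiv ℝ (fderiv ℝ f) z) (z + (0 : ℝ) • e) := by
        simpa using h2.hasFDerivAt
      have h4 : HasDerivAt (fun s : ℝ => fderiv ℝ f (z + s • e)) (fderiv ℝ (fderiv ℝ f) z e) 0 :=
        h3.comp_hasDerivAt (0 : ℝ) (hline 0)
      have h5 := h4.clm_apply (hasDerivAt_const (0 : ℝ) e)
      rw [map_zero, add_zero] at h5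
      exact h5
  · rw [InnerProductSpace.laplacian_eq_iteratedFDeriv_orthonormalBasis f
      (EuclideanSpace.basisFun ι ℝ)]
    simp [iteratedFDeriv_two_apply]

lemma norm_add_smul_single_sub_sq (z c : EuclideanSpace ℝ ι) (i : ι) (s : ℝ) :
    ‖z + s • EuclideanSpace.single i (1 : ℝ) - c‖ ^ 2
      = ‖z - c‖ ^ 2 + 2 * s * (z i - c i) + s ^ 2 := by
  rw [add_sub_right_comm, norm_add_sq_real, inner_smul_right, EuclideanSpace.inner_single_right,
    norm_smul, mul_pow]
  simp
  ring

lemma hasDerivAt_norm_add_smul_single_sub_sq (z c : EuclideanSpace ℝ ι) (i : ι) (s : ℝ) :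
    HasDerivAt (fun s : ℝ => ‖z + s • EuclideanSpace.single i (1 : ℝ) - c‖ ^ 2)
      (2 * (z i - c i) + 2 * s) s := by
  simp only [norm_add_smul_single_sub_sq]
  have := (((hasDerivAt_id s).const_mul 2).mul_const (z i - c i)).const_add (‖z - c‖ ^ 2)
    |>.fun_add ((hasDerivAt_id s).fun_pow 2)
  exact this.congr_deriv (by simp)

lemma hasLaplacianAt_radial {F F' : ℝ → ℝ} {F'' : ℝ} (z c : EuclideanSpace ℝ ι)
    (hF : ∀ᶠ t in 𝓝 (‖z - c‖ ^ 2), HasDerivAt F (F' t) t)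
    (hF' : HasDerivAt F' F'' (‖z - c‖ ^ 2)) :
    HasLaplacianAt (fun x => F (‖x - c‖ ^ 2))
      (4 * ‖z - c‖ ^ 2 * F'' + 2 * Fintype.card ι * F' (‖z - c‖ ^ 2)) z := by
  refine ⟨fun i => 4 * (z i - c i) ^ 2 * F'' + 2 * F' (‖z - c‖ ^ 2), fun i => ?_, ?_⟩
  · set e : EuclideanSpace ℝ ι := EuclideanSpace.single i 1
    have hd := hasDerivAt_norm_add_smul_single_sub_sq z c i
    refine ⟨fun s => F' (‖z + s • e - c‖ ^ 2) * (2 * (z i - c i) + 2 * s), ?_, ?_⟩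
    · have ht : Tendsto (fun s : ℝ => ‖z + s • e - c‖ ^ 2) (𝓝 0) (𝓝 (‖z - c‖ ^ 2)) := by
        simpa using (hd 0).continuousAt.tendsto
      filter_upwards [ht.eventually hF] with s hs
      exact hs.comp s (hd s)
    · have h1 : HasDerivAt F' F'' (‖z + (0 : ℝ) • e - c‖ ^ 2) := by simpa using hF'
      have h2 : HasDerivAt (fun s : ℝ => 2 * (z i - c i) + 2 * s) 2 0 := by
        simpa using ((hasDerivAt_id (0 : ℝ)).const_mul 2).const_add (2 * (z i - c i))
      have := (h1.comp (0 : ℝ) (hd 0)).mul h2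
      refine this.congr_deriv ?_
      simp
      ring
  · rw [Finset.sum_add_distrib, ← Finset.sum_mul, ← Finset.mul_sum, ← norm_sub_sq_eq_sum]
    simp
    ring

lemma hasLaplacianAt_two_coords {F : ℝ → ℝ → ℝ} {a b : ℝ} {i j : ι} (hij : i ≠ j)
    (z : EuclideanSpace ℝ ι) (ha : HasSecondDerivAtZero (fun s => F (z i + s) (z j)) a)
    (hb : HasSecondDerivAtZero (fun s => F (z i) (z j + s)) b) :
    HasLaplacianAt (fun x => F (x i) (x j)) (a + b) z := by
  refine ⟨fun k => (if k = i then a else 0) + (if k = j then b else 0), fun k => ?_, by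
    simp [Finset.sum_add_distrib]⟩
  by_cases hi : k = i
  · subst hi
    simpa [hij, hij.symm] using ha
  by_cases hj : k = j
  · subst hj
    simpa [hij, hij.symm] using hb
  · simpa [hi, hj, Ne.symm hi, Ne.symm hj] using HasSecondDerivAtZero.const (F (z i) (z j))

end Lines

/-- A one-sided derivative at a one-sided minimum is nonnegative. -/
lemma HasDerivWithinAt.nonneg_of_eventually_le {φ : ℝ → ℝ} {d : ℝ}
    (h : HasDerivWithinAt φ d (Ici 0) 0) (hmin : ∀ᶠ s in 𝓝[>] (0 : ℝ), φ 0 ≤ φ s) : 0 ≤ d := by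
  have h1 := (hasDerivWithinAt_iff_tendsto_slope' (by simp : (0 : ℝ) ∉ Ioi 0)).1
    (h.mono Ioi_subset_Ici_self)
  refine ge_of_tendsto h1 ?_
  filter_upwards [hmin, self_mem_nhdsWithin] with s hs hs0
  rw [slope_def_field]
  exact div_nonneg (by linarith) (by simpa using (le_of_lt hs0))

/-- The part of the closed quarter space `{z i ≥ 0, z j ≥ 0}` in a spherical shell around `c`. -/
def quarterShell {ι : Type*} [Fintype ι] (i j : ι) (c : EuclideanSpace ℝ ι)
    (a b : ℝ) : Set (EuclideanSpace ℝ ι) :=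
  {z | 0 ≤ z i ∧ 0 ≤ z j ∧ a ≤ ‖z - c‖ ^ 2 ∧ ‖z - c‖ ^ 2 ≤ b}

lemma isCompact_quarterShell {ι : Type*} [Fintype ι] (i j : ι) (c : EuclideanSpace ℝ ι)
    (a b : ℝ) :
    IsCompact (quarterShell i j c a b) := by
  refine (isCompact_closedBall c (√b)).of_isClosed_subset ?_ fun z hz => ?_
  · have h1 : ∀ k, Continuous fun z : EuclideanSpace ℝ ι => z k := fun k => by fun_prop
    have h2 : Continuous fun z : EuclideanSpace ℝ ι => ‖z - c‖ ^ 2 := by fun_prop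
    exact (isClosed_le continuous_const (h1 i)).inter ((isClosed_le continuous_const (h1 j)).inter
      ((isClosed_le continuous_const h2).inter (isClosed_le h2 continuous_const)))
  · rw [Metric.mem_closedBall, dist_eq_norm]
    exact Real.le_sqrt_of_sq_le hz.2.2.2

/-! ### Hopf barrier and minimum principle in thin shells -/

section MinimumPrinciples

variable {ι : Type*} [Fintype ι] [DecidableEq ι]

/-- Propagation of positivity for harmonic functions in a half-space, up to the boundary. -/
lemma pos_on_ball_of_harmonic {w : EuclideanSpace ℝ ι → ℝ} {j : ι} {z₁ : EuclideanSpace ℝ ι}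
    {R : ℝ} (hR : 0 < R) (hz₁ : 0 < z₁ j)
    (hc : ContinuousOn w (Metric.closedBall z₁ R ∩ {z | 0 ≤ z j}))
    (h0 : ∀ z ∈ Metric.closedBall z₁ R ∩ {z | 0 ≤ z j}, 0 ≤ w z) (h1 : 0 < w z₁)
    (hlap : ∀ z ∈ Metric.ball z₁ R, 0 < z j → HasLaplacianAt w 0 z)
    (hbot : ∀ z ∈ Metric.ball z₁ R, z j = 0 → ∃ d ≤ 0,
      HasDerivWithinAt (fun s : ℝ => w (z + s • EuclideanSpace.single j (1 : ℝ))) d (Ici 0) 0) :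
    ∀ z ∈ Metric.ball z₁ R, 0 ≤ z j → 0 < w z := by
  set S := Metric.closedBall z₁ R ∩ {z | 0 ≤ z j} with hS
  have hSc : IsCompact S := (isCompact_closedBall z₁ R).inter_right
    (isClosed_le continuous_const (by fun_prop))
  have hz₁S : z₁ ∈ S := ⟨Metric.mem_closedBall_self hR.le, hz₁.le⟩
  set m := w z₁ / 2 with hm
  have hm0 : 0 < m := by positivity
  obtain ⟨r, hr, hrw⟩ := Metric.mem_nhdsWithin_iff.1
    ((hc z₁ hz₁S).eventually (lt_mem_nhds (by linarith : m < w z₁)))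
  set N : ℝ := (Fintype.card ι : ℝ) with hN
  have hN1 : 0 < N := by
    have : Nonempty ι := ⟨j⟩
    exact Nat.cast_pos.2 Fintype.card_pos
  -- Large enough for the Gaussian barrier `F` to be strictly subharmonic at distance at least `r`
  -- from `z₁`.
  set α := N / r ^ 2 with hα
  have hα0 : 0 < α := by positivity
  set F : ℝ → ℝ := fun t => Real.exp (-α * t) - Real.exp (-α * R ^ 2) with hF
  have hF1 : ∀ t, HasDerivAt F (-α * Real.exp (-α * t)) t := fun t => by
    have := (((hasDerivAt_id t).const_mul (-α)).exp).sub_const (Real.exp (-α * R ^ 2))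
    exact this.congr_deriv (by simp [mul_comm])
  have hF2 : ∀ t, HasDerivAt (fun t => -α * Real.exp (-α * t)) (α ^ 2 * Real.exp (-α * t)) t := by
    intro t
    have := (((hasDerivAt_id t).const_mul (-α)).exp).const_mul (-α)
    exact this.congr_deriv (by simp; ring)
  set v : EuclideanSpace ℝ ι → ℝ := fun z => w z + (-m) * F (‖z - z₁‖ ^ 2) with hv
  have hvc : ContinuousOn v S := by
    refine hc.add (Continuous.continuousOn ?_)
    simp only [hF]
    fun_prop
  have key : ∀ z ∈ S, 0 ≤ v z := by
    obtain ⟨z₀, hz₀, hmin⟩ := hSc.exists_isMinOn ⟨z₁, hz₁S⟩ hvc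
    rw [isMinOn_iff] at hmin
    by_contra! hneg
    obtain ⟨x, hx, hxneg⟩ := hneg
    have hv0 : v z₀ < 0 := (hmin x hx).trans_lt hxneg
    have hle : ‖z₀ - z₁‖ ≤ R := by simpa [dist_eq_norm] using hz₀.1
    rcases lt_or_ge ‖z₀ - z₁‖ r with h | h
    · have h2 : m < w z₀ := hrw ⟨by simpa [dist_eq_norm] using h, hz₀⟩
      have h3 : F (‖z₀ - z₁‖ ^ 2) ≤ 1 := by
        have h4 : Real.exp (-α * ‖z₀ - z₁‖ ^ 2) ≤ 1 := Real.exp_le_one_iff.2 (by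
          have : 0 ≤ α * ‖z₀ - z₁‖ ^ 2 := by positivity
          linarith)
        have := Real.exp_pos (-α * R ^ 2)
        simp only [hF]
        linarith
      have : m * F (‖z₀ - z₁‖ ^ 2) ≤ m * 1 := mul_le_mul_of_nonneg_left h3 hm0.le
      simp only [hv] at hv0
      linarith
    rcases hle.eq_or_lt with h' | h'
    · have : v z₀ = w z₀ := by simp [hv, hF, h']
      linarith [h0 z₀ hz₀]
    have hball : z₀ ∈ Metric.ball z₁ R := by simpa [dist_eq_norm] using h'
    have hball' := Metric.isOpen_ball.mem_nhds hball
    rcases (show (0 : ℝ) ≤ z₀ j from hz₀.2).eq_or_lt with hj | hj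
    · obtain ⟨d, hd, hdw⟩ := hbot z₀ hball hj.symm
      have h2 : HasDerivAt F (-α * Real.exp (-α * ‖z₀ - z₁‖ ^ 2))
          (‖z₀ + (0 : ℝ) • EuclideanSpace.single j (1 : ℝ) - z₁‖ ^ 2) := by
        simpa using hF1 (‖z₀ - z₁‖ ^ 2)
      have h3 := (h2.comp (0 : ℝ) (hasDerivAt_norm_add_smul_single_sub_sq z₀ z₁ j 0)).const_mul (-m)
      have h4 := (hdw.fun_add h3.hasDerivWithinAt).nonneg_of_eventually_le (by
        have h5 := (tendsto_add_smul_nhds_zero z₀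
          (EuclideanSpace.single j (1 : ℝ))).eventually hball'
        filter_upwards [nhdsWithin_le_nhds h5, self_mem_nhdsWithin] with s hs hs0
        have hs1 : (0 : ℝ) < s := hs0
        have := hmin (z₀ + s • EuclideanSpace.single j (1 : ℝ))
          ⟨Metric.ball_subset_closedBall hs, by simp [← hj, hs1.le]⟩
        simpa [hv] using this)
      -- As `z₁` lies above the flat boundary, moving up from it approaches `z₁`: the barrier
      -- increases and `v` strictly decreases, so no minimum sits there.
      have h6 : 0 < m * (α * Real.exp (-α * ‖z₀ - z₁‖ ^ 2) * (2 * z₁ j)) := by positivity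
      rw [← hj] at h4
      linarith
    · have hlv := (hlap z₀ hball hj).add ((hasLaplacianAt_radial z₀ z₁
        (Eventually.of_forall hF1) (hF2 _)).const_mul (-m))
      have hcj : Continuous fun z : EuclideanSpace ℝ ι => z j := by fun_prop
      have hnhds : S ∈ 𝓝 z₀ := inter_mem
        (mem_of_superset hball' Metric.ball_subset_closedBall)
        ((hcj.tendsto z₀).eventually_const_le hj)
      have h2 := hlv.nonneg_of_isLocalMin (mem_of_superset hnhds fun z hz => hmin z hz)
      have h3 : N ≤ α * ‖z₀ - z₁‖ ^ 2 := by
        rw [hα, div_mul_eq_mul_div, le_div_iff₀ (by positivity)]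
        gcongr
      have h4 : 0 < m * (2 * α * Real.exp (-α * ‖z₀ - z₁‖ ^ 2)) *
          (2 * (α * ‖z₀ - z₁‖ ^ 2) - N) :=
        mul_pos (by positivity) (by linarith)
      have h5 : 0 + -m * (4 * ‖z₀ - z₁‖ ^ 2 * (α ^ 2 * Real.exp (-α * ‖z₀ - z₁‖ ^ 2)) +
          2 * N * (-α * Real.exp (-α * ‖z₀ - z₁‖ ^ 2))) =
          -(m * (2 * α * Real.exp (-α * ‖z₀ - z₁‖ ^ 2)) *
          (2 * (α * ‖z₀ - z₁‖ ^ 2) - N)) := by ring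
      rw [h5] at h2
      linarith
  intro z hz hzj
  have hz' : ‖z - z₁‖ < R := by simpa [dist_eq_norm] using hz
  have h2 := key z ⟨Metric.ball_subset_closedBall hz, hzj⟩
  have h3 : 0 < F (‖z - z₁‖ ^ 2) := by
    simp only [hF, sub_pos, Real.exp_lt_exp]
    have : ‖z - z₁‖ ^ 2 < R ^ 2 := by gcongr
    nlinarith
  have := mul_pos hm0 h3
  simp only [hv] at h2
  linarith

/-- Minimum principle in a thin spherical shell, with a Robin condition of arbitrary size on the
flat part of the boundary. -/
lemma nonneg_on_thin_quarterShell {w : EuclideanSpace ℝ ι → ℝ} {i j : ι} (hij : i ≠ j)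
    {c : EuclideanSpace ℝ ι} (hcj : c j = 0) {K r μ : ℝ} (hK : 0 ≤ K) (hr : 0 < r)
    (hthin : (K + 1) * (μ - r ^ 2) ≤ r) (hc : ContinuousOn w (quarterShell i j c (r ^ 2) μ))
    (hbdry : ∀ z ∈ quarterShell i j c (r ^ 2) μ,
      z i = 0 ∨ ‖z - c‖ ^ 2 = r ^ 2 ∨ ‖z - c‖ ^ 2 = μ → 0 ≤ w z)
    (hlap : ∀ z ∈ quarterShell i j c (r ^ 2) μ, 0 < z i → 0 < z j → HasLaplacianAt w 0 z)
    (hbot : ∀ z ∈ quarterShell i j c (r ^ 2) μ, 0 < z i → z j = 0 → w z < 0 → ∃ d ≤ -K * w z,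
      HasDerivWithinAt (fun s : ℝ => w (z + s • EuclideanSpace.single j (1 : ℝ))) d (Ici 0) 0) :
    ∀ z ∈ quarterShell i j c (r ^ 2) μ, 0 ≤ w z := by
  set S := quarterShell i j c (r ^ 2) μ with hS
  intro z hz
  set k := K + 1 with hk
  -- The comparison function is `g = G(y) + F(|x - c|²)`. This `A` makes the radial part contribute
  -- at most `-2 k²` to the Laplacian, beating `G'' = k²`, while `hthin` keeps `|F| ≤ 1/4` on the
  -- shell, below `G ≥ 1/2`.
  set A := k ^ 2 / (4 * r ^ 2) with hA
  have hk0 : 0 < k := by linarith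
  have hA0 : 0 < A := by positivity
  set F : ℝ → ℝ := fun t => -A * (t - r ^ 2) ^ 2 with hF
  have hF1 : ∀ t, HasDerivAt F (-A * (2 * (t - r ^ 2))) t := fun t => by
    have := (((hasDerivAt_id t).sub_const (r ^ 2)).fun_pow 2).const_mul (-A)
    exact this.congr_deriv (by simp)
  have hF2 : ∀ t, HasDerivAt (fun t => -A * (2 * (t - r ^ 2))) (-A * 2) t := fun t => by
    have := (((hasDerivAt_id t).sub_const (r ^ 2)).const_mul 2).const_mul (-A)
    exact this.congr_deriv (by simp)
  set G : ℝ → ℝ := fun y => 1 - k * y + k ^ 2 / 2 * y ^ 2 with hG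
  have hG1 : ∀ y s, HasDerivAt (fun s => G (y + s)) (-k + k ^ 2 * (y + s)) s := fun y s => by
    have h := (hasDerivAt_id s).const_add y
    have := ((h.const_mul k).const_sub 1).fun_add ((h.fun_pow 2).const_mul (k ^ 2 / 2))
    exact this.congr_deriv (by simp; ring)
  have hG2 : ∀ y s, HasDerivAt (fun s => -k + k ^ 2 * (y + s)) (k ^ 2) s := fun y s => by
    have := (((hasDerivAt_id s).const_add y).const_mul (k ^ 2)).const_add (-k)
    exact this.congr_deriv (by simp)
  set g : EuclideanSpace ℝ ι → ℝ := fun x => G (x j) + F (‖x - c‖ ^ 2) with hg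
  have hgc : Continuous g := by
    simp only [hg, hG, hF]
    fun_prop
  have hgpos : ∀ x ∈ S, 0 < g x := by
    rintro x ⟨-, -, hx1, hx2⟩
    have h1 : 1 / 2 ≤ G (x j) := by
      simp only [hG]
      nlinarith [sq_nonneg (k * x j - 1)]
    have h2 : (‖x - c‖ ^ 2 - r ^ 2) * k ≤ r := by
      refine le_trans ?_ hthin
      rw [mul_comm]
      gcongr
    have h3 : A * (‖x - c‖ ^ 2 - r ^ 2) ^ 2 ≤ 1 / 4 := by
      have h4 : ((‖x - c‖ ^ 2 - r ^ 2) * k) ^ 2 ≤ r ^ 2 :=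
        pow_le_pow_left₀ (mul_nonneg (by linarith) hk0.le) h2 2
      rw [hA, div_mul_eq_mul_div, div_le_iff₀ (by positivity)]
      nlinarith
    simp only [hg, hF]
    linarith
  obtain ⟨z₀, hz₀, hmin⟩ := (isCompact_quarterShell i j c (r ^ 2) μ).exists_isMinOn ⟨z, hz⟩
    (hc.div hgc.continuousOn fun x hx => (hgpos x hx).ne')
  rw [isMinOn_iff] at hmin
  by_contra! hneg
  -- The number for which `w + s * g` is nonnegative and vanishes at `z₀`.
  set s := -(w z₀ / g z₀) with hs
  have hs0 : 0 < s := by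
    have h1 : w z₀ / g z₀ ≤ w z / g z := hmin z hz
    have h2 : w z / g z < 0 := div_neg_of_neg_of_pos hneg (hgpos z hz)
    linarith
  set v : EuclideanSpace ℝ ι → ℝ := fun x => w x + s * g x with hv
  have hw0 : w z₀ = -s * g z₀ := by
    rw [hs]
    field_simp [(hgpos z₀ hz₀).ne']
  have hvz₀ : v z₀ = 0 := by simp only [hv, hw0]; ring
  have hvS : ∀ x ∈ S, v z₀ ≤ v x := by
    intro x hx
    rw [hvz₀]
    have h1 : w z₀ / g z₀ ≤ w x / g x := hmin x hx
    have h2 : -s * g x ≤ w x := by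
      rw [← le_div_iff₀ (hgpos x hx)]
      linarith
    simp only [hv]
    linarith
  have hw0neg : w z₀ < 0 := by
    rw [hw0]
    nlinarith [mul_pos hs0 (hgpos z₀ hz₀)]
  have hnot : ∀ h : z₀ i = 0 ∨ ‖z₀ - c‖ ^ 2 = r ^ 2 ∨ ‖z₀ - c‖ ^ 2 = μ, False :=
    fun h => absurd (hbdry z₀ hz₀ h) (not_le.2 hw0neg)
  have hi : 0 < z₀ i := lt_of_le_of_ne hz₀.1 fun h => hnot (Or.inl h.symm)
  have hρ1 : r ^ 2 < ‖z₀ - c‖ ^ 2 :=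
    lt_of_le_of_ne hz₀.2.2.1 fun h => hnot (Or.inr (Or.inl h.symm))
  have hρ2 : ‖z₀ - c‖ ^ 2 < μ := lt_of_le_of_ne hz₀.2.2.2 fun h => hnot (Or.inr (Or.inr h))
  have hnhds : ∀ᶠ x in 𝓝 z₀, 0 < x i ∧ r ^ 2 < ‖x - c‖ ^ 2 ∧ ‖x - c‖ ^ 2 < μ := by
    have h1 : Continuous fun z : EuclideanSpace ℝ ι => z i := by fun_prop
    have h2 : Continuous fun z : EuclideanSpace ℝ ι => ‖z - c‖ ^ 2 := by fun_prop
    exact ((h1.tendsto z₀).eventually_const_lt hi).and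
      (((h2.tendsto z₀).eventually_const_lt hρ1).and ((h2.tendsto z₀).eventually_lt_const hρ2))
  rcases hz₀.2.1.eq_or_lt with hj | hj
  · obtain ⟨d, hd, hdw⟩ := hbot z₀ hz₀ hi hj.symm hw0neg
    have h2 : HasDerivAt F (-A * (2 * (‖z₀ - c‖ ^ 2 - r ^ 2)))
        (‖z₀ + (0 : ℝ) • EuclideanSpace.single j (1 : ℝ) - c‖ ^ 2) := by
      simpa using hF1 (‖z₀ - c‖ ^ 2)
    have h3 := ((hG1 0 0).fun_add
      (h2.comp (0 : ℝ) (hasDerivAt_norm_add_smul_single_sub_sq z₀ c j 0))).const_mul s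
    have h4 := (hdw.fun_add h3.hasDerivWithinAt).nonneg_of_eventually_le (by
      have h5 := (tendsto_add_smul_nhds_zero z₀
        (EuclideanSpace.single j (1 : ℝ))).eventually hnhds
      filter_upwards [nhdsWithin_le_nhds h5, self_mem_nhdsWithin] with t ht ht0
      have ht1 : (0 : ℝ) < t := ht0
      have := hvS (z₀ + t • EuclideanSpace.single j (1 : ℝ))
        ⟨ht.1.le, by simp [← hj, ht1.le], ht.2.1.le, ht.2.2.le⟩
      simpa [hv, hg, ← hj] using this)
    have hg1 : g z₀ ≤ 1 := by
      simp only [hg, hG, hF, ← hj]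
      nlinarith [mul_nonneg hA0.le (sq_nonneg (‖z₀ - c‖ ^ 2 - r ^ 2))]
    rw [hw0] at hd
    rw [← hj, hcj] at h4
    -- Since `c j = 0`, the radial part has no normal derivative here. So `g` has normal derivative
    -- `-k = -(K + 1)`, and with `g ≤ 1` this overcomes the Robin term.
    have h6 : K * (s * g z₀) ≤ K * (s * 1) := by gcongr
    nlinarith
  · have hlv := (hlap z₀ hz₀ hi hj).add (((hasLaplacianAt_two_coords (F := fun _ y => G y) hij z₀
      (HasSecondDerivAtZero.const _)
      ⟨_, Eventually.of_forall (hG1 (z₀ j)), hG2 (z₀ j) 0⟩).add (hasLaplacianAt_radial z₀ c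
      (Eventually.of_forall hF1) (hF2 _))).const_mul s)
    have hjn : ∀ᶠ x in 𝓝 z₀, 0 < x j := (isOpen_lt continuous_const (by fun_prop)).mem_nhds hj
    have h2 := hlv.nonneg_of_isLocalMin (by
      filter_upwards [hnhds, hjn] with x hx hxj
      exact hvS x ⟨hx.1.le, hxj.le, hx.2.1.le, hx.2.2.le⟩)
    have h3 : 2 * k ^ 2 < 8 * A * ‖z₀ - c‖ ^ 2 := by
      have : 2 * k ^ 2 = 8 * A * r ^ 2 := by
        rw [hA]
        field_simp
        norm_num
      rw [this]
      gcongr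
    have h4 : 0 ≤ A * Fintype.card ι * (‖z₀ - c‖ ^ 2 - r ^ 2) :=
      mul_nonneg (by positivity) (by linarith)
    have h5 : 0 < k ^ 2 := by positivity
    have h6 : 0 < s * (8 * A * ‖z₀ - c‖ ^ 2
        + 4 * (A * Fintype.card ι * (‖z₀ - c‖ ^ 2 - r ^ 2)) - k ^ 2) :=
      mul_pos hs0 (by linarith)
    nlinarith

end MinimumPrinciples

/-! ### Inversion and the Kelvin transform -/

section Kelvin

/-- Inversion of `z` in the sphere with centre `c` and squared radius `μ`. -/
noncomputable def sphereInversion {ι : Type*} [Fintype ι] (c : EuclideanSpace ℝ ι) (μ : ℝ)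
    (z : EuclideanSpace ℝ ι) : EuclideanSpace ℝ ι :=
  c + (μ / ‖z - c‖ ^ 2) • (z - c)

/-- The Kelvin transform of `u` with weight exponent `m`, for the sphere with centre `c` and
squared radius `μ`. -/
noncomputable def kelvinTransform {ι : Type*} [Fintype ι] (m : ℝ) (u : EuclideanSpace ℝ ι → ℝ)
    (c : EuclideanSpace ℝ ι) (μ : ℝ) (z : EuclideanSpace ℝ ι) : ℝ :=
  (μ / ‖z - c‖ ^ 2) ^ m * u (sphereInversion c μ z)

variable {ι : Type*} [Fintype ι] [DecidableEq ι]

lemma hasDerivAt_div_rpow (m : ℝ) {μ t : ℝ} (hμ : 0 < μ) (ht : 0 < t) :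
    HasDerivAt (fun t => (μ / t) ^ m) (-(m / t) * (μ / t) ^ m) t := by
  have h1 : HasDerivAt (fun t : ℝ => μ / t) (-(μ / t ^ 2)) t := by
    have := (hasDerivAt_inv ht.ne').const_mul μ
    simpa [div_eq_mul_inv] using this
  have h2 := h1.rpow_const (p := m) (Or.inl (by positivity))
  refine h2.congr_deriv ?_
  rw [Real.rpow_sub_one (by positivity)]
  field_simp

lemma hasDerivAt_add_smul {E : Type*} [NormedAddCommGroup E] [NormedSpace ℝ E] (z e : E) (s : ℝ) :
    HasDerivAt (fun s : ℝ => z + s • e) e s := by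
  simpa using ((hasDerivAt_id s).smul_const e).const_add z

lemma hasDerivAt_sphereInversion_line (μ : ℝ) (z c : EuclideanSpace ℝ ι) (i : ι)
    {s : ℝ} (hs : 0 < ‖z + s • EuclideanSpace.single i (1 : ℝ) - c‖ ^ 2) :
    HasDerivAt (fun s : ℝ => sphereInversion c μ (z + s • EuclideanSpace.single i (1 : ℝ)))
      ((μ / ‖z + s • EuclideanSpace.single i (1 : ℝ) - c‖ ^ 2) • EuclideanSpace.single i (1 : ℝ) +
        (-(μ * (2 * (z i - c i) + 2 * s)) /
          (‖z + s • EuclideanSpace.single i (1 : ℝ) - c‖ ^ 2) ^ 2) •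
          (z + s • EuclideanSpace.single i (1 : ℝ) - c)) s := by
  have h1 := (hasDerivAt_norm_add_smul_single_sub_sq z c i s).fun_inv hs.ne'
  have h2 := h1.const_mul μ
  have h3 := (h2.fun_smul ((hasDerivAt_add_smul z (EuclideanSpace.single i (1 : ℝ)) s).sub_const
    c)).const_add c
  simp only [sphereInversion, div_eq_mul_inv]
  refine h3.congr_deriv ?_
  congr 2
  rw [div_eq_mul_inv]
  ring

lemma sum_smul_single (q : EuclideanSpace ℝ ι) :
    ∑ i, q i • EuclideanSpace.single i (1 : ℝ) = q := by
  ext k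
  simp [Pi.single_apply]

/-- The Kelvin transform of a harmonic function is harmonic. -/
lemma hasLaplacianAt_kelvinTransform {u : EuclideanSpace ℝ ι → ℝ} {m μ : ℝ}
    (hm : 2 * m + 2 = Fintype.card ι) (hμ : 0 < μ) {z c : EuclideanSpace ℝ ι} (hzc : z ≠ c)
    (hu : ContDiffAt ℝ 2 u (sphereInversion c μ z))
    (hΔ : (Δ u) (sphereInversion c μ z) = 0) :
    HasLaplacianAt (kelvinTransform m u c μ) 0 z := by
  set q := z - c with hq
  set ρ := ‖q‖ ^ 2 with hρ
  have hρ0 : 0 < ρ := by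
    have : q ≠ 0 := sub_ne_zero.2 hzc
    positivity
  set P := sphereInversion c μ z with hP
  set ℓ := fderiv ℝ u P with hℓ
  set B := fderiv ℝ (fderiv ℝ u) P with hB
  have hBsum : ∑ i, B (EuclideanSpace.single i 1) (EuclideanSpace.single i 1) = 0 := by
    rw [← hΔ, InnerProductSpace.laplacian_eq_iteratedFDeriv_orthonormalBasis u
      (EuclideanSpace.basisFun ι ℝ)]
    simp [iteratedFDeriv_two_apply, hB]
  refine ⟨fun i => (μ / ρ) ^ m * (u P * ((4 * m ^ 2 + 4 * m) / ρ ^ 2 * q i ^ 2 - 2 * m / ρ)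
    + -(4 * m + 4) * μ / ρ ^ 2 * (q i * ℓ (EuclideanSpace.single i 1))
    + ℓ q * ((8 * m + 8) * μ / ρ ^ 3 * q i ^ 2 - 2 * μ / ρ ^ 2)
    + (μ / ρ) ^ 2 * B (EuclideanSpace.single i 1) (EuclideanSpace.single i 1)
    + -2 * μ ^ 2 / ρ ^ 3 * (q i * B (EuclideanSpace.single i 1) q)
    + -2 * μ ^ 2 / ρ ^ 3 * (q i * B q (EuclideanSpace.single i 1))
    + 4 * μ ^ 2 / ρ ^ 4 * B q q * q i ^ 2), fun i => ?_, ?_⟩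
  · set e : EuclideanSpace ℝ ι := EuclideanSpace.single i 1 with he
    have hqi : z i - c i = q i := by simp [hq]
    set N : ℝ → ℝ := fun s => ‖z + s • e - c‖ ^ 2 with hN
    have hN0 : N 0 = ρ := by simp [hN, hρ, hq]
    have hNd : ∀ s, HasDerivAt N (2 * q i + 2 * s) s := fun s => by
      have := hasDerivAt_norm_add_smul_single_sub_sq z c i s
      rwa [hqi] at this
    have hNpos : ∀ᶠ s in 𝓝 (0 : ℝ), 0 < N s := by
      have := (hNd 0).continuousAt.tendsto
      rw [hN0] at this
      exact this.eventually_const_lt hρ0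
    set γ : ℝ → EuclideanSpace ℝ ι := fun s => sphereInversion c μ (z + s • e) with hγ
    have hγ0 : γ 0 = P := by simp [hγ, hP]
    set γ' : ℝ → EuclideanSpace ℝ ι := fun s =>
      (μ / N s) • e + (-(μ * (2 * q i + 2 * s)) / N s ^ 2) • (z + s • e - c) with hγ'
    have hγd : ∀ s, 0 < N s → HasDerivAt γ (γ' s) s := fun s hs => by
      have := hasDerivAt_sphereInversion_line μ z c i hs
      rwa [hqi] at this
    have hγ'0 : γ' 0 = (μ / ρ) • e + (-(μ * (2 * q i)) / ρ ^ 2) • q := by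
      simp [hγ', hN0, hq]
    set h : ℝ → ℝ := fun s => (μ / N s) ^ m with hh
    have hh0 : h 0 = (μ / ρ) ^ m := by simp [hh, hN0]
    have hhd : ∀ s, 0 < N s → HasDerivAt h (-(m / N s) * h s * (2 * q i + 2 * s)) s :=
      fun s hs => (hasDerivAt_div_rpow m hμ hs).comp s (hNd s)
    have hγt : Tendsto γ (𝓝 0) (𝓝 P) := by
      have := (hγd 0 (by rw [hN0]; exact hρ0)).continuousAt.tendsto
      rwa [hγ0] at this
    have hdiff : ∀ᶠ x in 𝓝 P, DifferentiableAt ℝ u x := by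
      filter_upwards [hu.eventually (by simp)] with x hx using hx.differentiableAt (by simp)
    refine ⟨fun s => -(m / N s) * h s * (2 * q i + 2 * s) * u (γ s)
      + h s * fderiv ℝ u (γ s) (γ' s), ?_, ?_⟩
    · filter_upwards [hNpos, hγt.eventually hdiff] with s hs hs'
      exact (hhd s hs).mul (hs'.hasFDerivAt.comp_hasDerivAt s (hγd s hs))
    · have hN0' : 0 < N 0 := by rw [hN0]; exact hρ0
      have hud : HasDerivAt (fun s => u (γ s)) (ℓ (γ' 0)) 0 := by
        have h1 : HasFDerivAt u ℓ (γ 0) := by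
          rw [hγ0]; exact hdiff.self_of_nhds.hasFDerivAt
        exact h1.comp_hasDerivAt (0 : ℝ) (hγd 0 hN0')
      have hDud : HasDerivAt (fun s => fderiv ℝ u (γ s)) (B (γ' 0)) 0 := by
        have h1 : HasFDerivAt (fderiv ℝ u) B (γ 0) := by
          rw [hγ0]
          exact ((hu.fderiv_right (m := 1) (by norm_num)).differentiableAt (by simp)).hasFDerivAt
        exact h1.comp_hasDerivAt (0 : ℝ) (hγd 0 hN0')
      have hlin : HasDerivAt (fun s : ℝ => 2 * q i + 2 * s) 2 0 := by
        simpa using ((hasDerivAt_id (0 : ℝ)).const_mul 2).const_add (2 * q i)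
      have hγ'd : HasDerivAt γ' ((-(4 * μ * q i) / ρ ^ 2) • e
          + (-2 * μ / ρ ^ 2 + 8 * μ * q i ^ 2 / ρ ^ 3) • q) 0 := by
        have h1 := ((hNd 0).fun_inv hN0'.ne').const_mul μ
        have h2 := (hlin.const_mul μ).fun_neg.fun_mul (((hNd 0).fun_pow 2).fun_inv
          (pow_ne_zero 2 hN0'.ne'))
        have h3 := (h1.smul_const e).fun_add
          (h2.fun_smul ((hasDerivAt_add_smul z e 0).sub_const c))
        refine (h3.congr_of_eventuallyEq (Eventually.of_forall fun s => by
          simp only [hγ', div_eq_mul_inv])).congr_deriv ?_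
        have h5 : z + (0 : ℝ) • e - c = q := by simp [hq]
        simp only [hN0, h5]
        rw [← add_assoc, ← add_smul]
        congr 2
        · field_simp
          ring
        · field_simp
          push_cast
          ring
      have h1 := (((hNd 0).fun_inv hN0'.ne').const_mul (-m)).fun_mul (hhd 0 hN0')
      have h2 := ((h1.fun_mul hlin).fun_mul hud).fun_add
        ((hhd 0 hN0').fun_mul (hDud.clm_apply hγ'd))
      refine (h2.congr_of_eventuallyEq (Eventually.of_forall fun s => by
        simp only [div_eq_mul_inv, neg_mul])).congr_deriv ?_
      simp only [hN0, hh0, hγ0, hγ'0, ← hℓ, map_add, map_smul, add_apply,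
        smul_apply, smul_eq_mul]
      field_simp
      ring
  -- After summation the coefficients of `u P`, `ℓ q` and `B q q` each cancel, the first two because
  -- `2 * m + 2` is the dimension.
  · have h1 : ∑ i, q i ^ 2 = ρ := by rw [hρ, EuclideanSpace.norm_sq_eq]; simp
    have h2 : ∑ i, q i * ℓ (EuclideanSpace.single i 1) = ℓ q := by
      conv_rhs => rw [← sum_smul_single q, map_sum]
      simp only [map_smul, smul_eq_mul]
    have h3 : ∑ i, q i * B q (EuclideanSpace.single i 1) = B q q := by
      conv_rhs => rw [← sum_smul_single q, map_sum]
      simp only [map_smul, smul_eq_mul, sum_smul_single]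
    have h4 : ∑ i, q i * B (EuclideanSpace.single i 1) q = B q q := by
      have : B q = ∑ i, q i • B (EuclideanSpace.single i 1) := by
        conv_lhs => rw [← sum_smul_single q, map_sum]
        simp only [map_smul]
      rw [this]
      simp
    rw [← Finset.mul_sum]
    simp only [Finset.sum_add_distrib, ← Finset.mul_sum, Finset.sum_sub_distrib, h1, h2, h3, h4,
      hBsum, Finset.sum_const, Finset.card_univ, nsmul_eq_mul, ← hm]
    field_simp
    ring

end Kelvin

/-! ### Solutions on the quarter space compared with their Kelvin transforms -/

section QuarterSolutions

variable {ι : Type*} [Fintype ι] [DecidableEq ι]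

/-- A continuous function on the whole space which solves the boundary value problem in the
quarter space `{z i > 0, z j > 0}`. -/
structure IsQuarterSolution (i j : ι) (p : ℝ) (v : EuclideanSpace ℝ ι → ℝ) : Prop where
  continuous : Continuous v
  nonneg : ∀ z, 0 ≤ v z
  pos : ∀ z, 0 < z i → 0 < z j → 0 < v z
  contDiffAt : ∀ z, 0 < z i → 0 < z j → ContDiffAt ℝ 2 v z
  harmonic : ∀ z, 0 < z i → 0 < z j → (Δ v) z = 0
  dirichlet : ∀ z, z i = 0 → v z = 0
  neumann : ∀ z, 0 < z i → z j = 0 → ∃ D : EuclideanSpace ℝ ι →L[ℝ] ℝ,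
    HasFDerivWithinAt v D {x | 0 ≤ x i ∧ 0 ≤ x j} z ∧ D (EuclideanSpace.single j 1) = -v z ^ p

/-- Positivity of harmonic functions in `O ∩ {z j > 0}` extends to the flat boundary. -/
lemma pos_on_flat_boundary {w : EuclideanSpace ℝ ι → ℝ} {j : ι} {O : Set (EuclideanSpace ℝ ι)}
    (hO : IsOpen O) (hc : ContinuousOn w O) (h0 : ∀ z ∈ O, 0 ≤ z j → 0 ≤ w z)
    (hpos : ∀ z ∈ O, 0 < z j → 0 < w z) (hlap : ∀ z ∈ O, 0 < z j → HasLaplacianAt w 0 z)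
    (hbot : ∀ z ∈ O, z j = 0 → ∃ d ≤ 0,
      HasDerivWithinAt (fun s : ℝ => w (z + s • EuclideanSpace.single j (1 : ℝ))) d (Ici 0) 0) :
    ∀ z ∈ O, z j = 0 → 0 < w z := by
  intro z hz hzj
  obtain ⟨ε, hε, hball⟩ := Metric.isOpen_iff.1 hO z hz
  -- The ball of radius `2 * η` about a point at height `η` above `z` contains `z` in its interior
  -- and stays inside `O`.
  set η := ε / 4 with hη
  have hη0 : 0 < η := by positivity
  set z₁ := z + η • EuclideanSpace.single j (1 : ℝ) with hz₁
  have hd : dist z z₁ = η := by simp [hz₁, norm_smul, hη0.le]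
  have hsub : Metric.closedBall z₁ (2 * η) ⊆ O := fun x hx => hball (by
    have h1 : dist x z₁ ≤ 2 * η := hx
    have h2 := dist_triangle x z₁ z
    rw [dist_comm z₁ z, hd] at h2
    rw [Metric.mem_ball]
    linarith)
  have hz₁j : 0 < z₁ j := by simp [hz₁, hzj, hη0]
  refine pos_on_ball_of_harmonic (by positivity : 0 < 2 * η) hz₁j
    (hc.mono (inter_subset_left.trans hsub)) (fun x hx => h0 x (hsub hx.1) hx.2)
    (hpos z₁ (hsub (Metric.mem_closedBall_self (by positivity))) hz₁j)
    (fun x hx hxj => hlap x (hsub (Metric.ball_subset_closedBall hx)) hxj)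
    (fun x hx hxj => hbot x (hsub (Metric.ball_subset_closedBall hx)) hxj) z ?_ hzj.ge
  rw [Metric.mem_ball, hd]
  linarith

/-- Strong maximum principle on convex open sets. -/
lemma pos_of_harmonic_of_convex {w : EuclideanSpace ℝ ι → ℝ} {j : ι}
    {C : Set (EuclideanSpace ℝ ι)} (hC : IsOpen C) (hconv : Convex ℝ C) (hCj : ∀ z ∈ C, 0 < z j)
    (hc : ContinuousOn w C) (h0 : ∀ z ∈ C, 0 ≤ w z) (hlap : ∀ z ∈ C, HasLaplacianAt w 0 z)
    (hne : ∃ z ∈ C, 0 < w z) : ∀ z ∈ C, 0 < w z := by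
  set P := C ∩ w ⁻¹' Ioi 0 with hP
  have hPo : IsOpen P := hc.isOpen_inter_preimage hC isOpen_Ioi
  obtain ⟨z₀, hz₀, hwz₀⟩ := hne
  -- The positivity set is open and relatively closed in `C`, which is connected.
  have hsub : C ⊆ P := hconv.isPreconnected.subset_of_closure_inter_subset hPo
    ⟨z₀, hz₀, hz₀, hwz₀⟩ (by
      rintro z ⟨hzP, hzC⟩
      obtain ⟨ε, hε, hball⟩ := Metric.isOpen_iff.1 hC z hzC
      obtain ⟨z₁, hz₁, hd⟩ := Metric.mem_closure_iff.1 hzP (ε / 3) (by positivity)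
      have hsub : Metric.closedBall z₁ (ε / 3) ⊆ C := fun x hx => hball (by
        have h1 : dist x z₁ ≤ ε / 3 := hx
        have h2 := dist_triangle x z₁ z
        rw [dist_comm z₁ z] at h2
        rw [Metric.mem_ball]
        linarith)
      refine ⟨hzC, pos_on_ball_of_harmonic (by positivity : 0 < ε / 3) (hCj z₁ hz₁.1)
        (hc.mono (inter_subset_left.trans hsub)) (fun x hx => h0 x (hsub hx.1)) hz₁.2
        (fun x hx _ => hlap x (hsub (Metric.ball_subset_closedBall hx)))
        (fun x hx hxj => absurd hxj (hCj x (hsub (Metric.ball_subset_closedBall hx))).ne')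
        z ?_ (hCj z hzC).le⟩
      rwa [Metric.mem_ball])
  exact fun z hz => (hsub hz).2

lemma HasLaplacianAt.sub {f g : EuclideanSpace ℝ ι → ℝ} {a b : ℝ} {z : EuclideanSpace ℝ ι}
    (hf : HasLaplacianAt f a z) (hg : HasLaplacianAt g b z) :
    HasLaplacianAt (fun x => f x - g x) (a - b) z := by
  simpa [sub_eq_add_neg] using hf.add (hg.const_mul (-1))

@[simp] lemma sphereInversion_apply {ι : Type*} [Fintype ι] (c : EuclideanSpace ℝ ι) (μ : ℝ)
    (z : EuclideanSpace ℝ ι) (k : ι) :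
    sphereInversion c μ z k = c k + μ / ‖z - c‖ ^ 2 * (z k - c k) := by
  simp [sphereInversion]

lemma sq_le_norm_sub_sq {ι : Type*} [Fintype ι] (z c : EuclideanSpace ℝ ι) (k : ι) :
    (z k - c k) ^ 2 ≤ ‖z - c‖ ^ 2 := by
  rw [norm_sub_sq_eq_sum]
  exact Finset.single_le_sum (f := fun k => (z k - c k) ^ 2) (fun _ _ => sq_nonneg _)
    (Finset.mem_univ k)

lemma kelvinTransform_of_norm_sq_eq {ι : Type*} [Fintype ι] (m : ℝ) (u : EuclideanSpace ℝ ι → ℝ)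
    {c z : EuclideanSpace ℝ ι} {μ : ℝ} (hμ : μ ≠ 0) (h : ‖z - c‖ ^ 2 = μ) :
    kelvinTransform m u c μ z = u z := by
  simp [kelvinTransform, sphereInversion, h, div_self hμ]

/-- Bernoulli's inequality for `a / b`. On a bounded cap this turns the nonlinear flux condition
into a linear Robin condition. -/
lemma rpow_sub_rpow_le {p M a b : ℝ} (hp : 1 ≤ p) (ha : 0 ≤ a) (hab : a < b) (hb : b ≤ M) :
    b ^ p - a ^ p ≤ p * M ^ (p - 1) * (b - a) := by
  have hb0 : 0 < b := ha.trans_lt hab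
  have h1 : 1 + p * (a / b - 1) ≤ (a / b) ^ p := by
    have h2 : -1 ≤ a / b - 1 := by
      have : 0 ≤ a / b := by positivity
      linarith
    simpa using one_add_mul_self_le_rpow_one_add h2 hp
  rw [Real.div_rpow ha hb0.le, le_div_iff₀ (by positivity)] at h1
  have h3 : b ^ p = b ^ (p - 1) * b := by
    rw [Real.rpow_sub_one hb0.ne']
    field_simp
  have h4 : (1 + p * (a / b - 1)) * b ^ p = b ^ p - p * b ^ (p - 1) * (b - a) := by
    rw [h3]
    field_simp
    ring
  have h5 : b ^ (p - 1) ≤ M ^ (p - 1) := Real.rpow_le_rpow hb0.le hb (by linarith)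
  have h6 : p * b ^ (p - 1) * (b - a) ≤ p * M ^ (p - 1) * (b - a) := by
    have : 0 ≤ b - a := by linarith
    gcongr
  linarith

lemma continuousAt_kelvinTransform {ι : Type*} [Fintype ι] {u : EuclideanSpace ℝ ι → ℝ}
    (hu : Continuous u) {m : ℝ} (hm : 0 ≤ m) {c z : EuclideanSpace ℝ ι} (hzc : z ≠ c) (μ : ℝ) :
    ContinuousAt (fun x : ℝ × EuclideanSpace ℝ ι => kelvinTransform m u c x.1 x.2) (μ, z) := by
  have hne : ‖z - c‖ ^ 2 ≠ 0 := by
    have : z - c ≠ 0 := sub_ne_zero.2 hzc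
    positivity
  have h1 : ContinuousAt (fun x : ℝ × EuclideanSpace ℝ ι => x.1 / ‖x.2 - c‖ ^ 2) (μ, z) :=
    ContinuousAt.div (by fun_prop) (by fun_prop) hne
  have h2 : ContinuousAt (fun x : ℝ × EuclideanSpace ℝ ι => sphereInversion c x.1 x.2) (μ, z) := by
    unfold sphereInversion
    exact continuousAt_const.add (h1.smul (by fun_prop))
  exact (h1.rpow_const (Or.inr hm)).mul (hu.continuousAt.comp h2)

lemma ne_of_apply_lt {ι : Type*} {c z : EuclideanSpace ℝ ι} {i : ι} (hci : c i < 0)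
    (hi : 0 ≤ z i) : z ≠ c := by
  rintro rfl
  linarith

lemma norm_sub_sq_pos {ι : Type*} [Fintype ι] {c z : EuclideanSpace ℝ ι} {i : ι}
    (hci : c i < 0) (hi : 0 ≤ z i) : 0 < ‖z - c‖ ^ 2 := by
  have := sub_ne_zero.2 (ne_of_apply_lt hci hi)
  positivity

/-- Inversion pushes points of the ball away from `c`, hence away from `{z i = 0}`, as `c i < 0`. -/
lemma apply_le_sphereInversion_apply {ι : Type*} [Fintype ι] {c z : EuclideanSpace ℝ ι}
    {i : ι} {μ : ℝ} (hci : c i < 0) (hi : 0 ≤ z i) (hz : ‖z - c‖ ^ 2 ≤ μ) :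
    z i ≤ sphereInversion c μ z i := by
  have h1 : 1 ≤ μ / ‖z - c‖ ^ 2 := by rwa [one_le_div (norm_sub_sq_pos hci hi)]
  rw [sphereInversion_apply]
  nlinarith

namespace IsQuarterSolution

variable {i j : ι} {p m : ℝ} {v : EuclideanSpace ℝ ι → ℝ} {c z : EuclideanSpace ℝ ι} {μ : ℝ}

lemma hasLaplacianAt (hv : IsQuarterSolution i j p v) (hi : 0 < z i) (hj : 0 < z j) :
    HasLaplacianAt v 0 z := by
  have := (hv.contDiffAt z hi hj).hasLaplacianAt
  rwa [hv.harmonic z hi hj] at this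

lemma hasDerivWithinAt_line (hv : IsQuarterSolution i j p v) (hij : i ≠ j) (hi : 0 < z i)
    (hj : z j = 0) :
    HasDerivWithinAt (fun s : ℝ => v (z + s • EuclideanSpace.single j (1 : ℝ))) (-v z ^ p)
      (Ici 0) 0 := by
  obtain ⟨D, hD, hDe⟩ := hv.neumann z hi hj
  rw [← hDe]
  have h1 : HasFDerivWithinAt v D {x | 0 ≤ x i ∧ 0 ≤ x j}
      (z + (0 : ℝ) • EuclideanSpace.single j (1 : ℝ)) := by simpa using hD
  refine h1.comp_hasDerivWithinAt (0 : ℝ) (hasDerivAt_add_smul z _ 0).hasDerivWithinAt ?_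
  intro s hs
  have hs0 : (0 : ℝ) ≤ s := hs
  simp [hj, hs0, hij, hi.le]

lemma pos_of_nonneg (hv : IsQuarterSolution i j p v) (hij : i ≠ j) (hi : 0 < z i)
    (hj : 0 ≤ z j) : 0 < v z := by
  rcases hj.eq_or_lt with hj | hj
  · have hci : Continuous fun z : EuclideanSpace ℝ ι => z i := by fun_prop
    exact pos_on_flat_boundary (O := {z | 0 < z i}) (isOpen_lt continuous_const hci)
      hv.continuous.continuousOn (fun z _ _ => hv.nonneg z) (fun z hz hzj => hv.pos z hz hzj)
      (fun z hz hzj => hv.hasLaplacianAt hz hzj)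
      (fun z hz hzj => ⟨_, neg_nonpos.2 (Real.rpow_nonneg (hv.nonneg z) p),
        hv.hasDerivWithinAt_line hij hz hzj⟩) z hi hj.symm
  · exact hv.pos z hi hj

lemma kelvinTransform_nonneg (hv : IsQuarterSolution i j p v) (hμ : 0 ≤ μ) :
    0 ≤ kelvinTransform m v c μ z :=
  mul_nonneg (Real.rpow_nonneg (by positivity) m) (hv.nonneg _)

lemma hasLaplacianAt_kelvinTransform_sub (hv : IsQuarterSolution i j p v)
    (hm : 2 * m + 2 = Fintype.card ι) (hcj : c j = 0) (hci : c i < 0) (hi : 0 < z i) (hj : 0 < z j)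
    (hz : ‖z - c‖ ^ 2 ≤ μ) :
    HasLaplacianAt (fun x => kelvinTransform m v c μ x - v x) 0 z := by
  have hρ := norm_sub_sq_pos hci hi.le
  have hμ : 0 < μ := hρ.trans_le hz
  have hI := hi.trans_le (apply_le_sphereInversion_apply hci hi.le hz)
  have hJ : 0 < sphereInversion c μ z j := by
    rw [sphereInversion_apply, hcj]
    simp only [zero_add, sub_zero]
    positivity
  simpa using (hasLaplacianAt_kelvinTransform hm hμ (ne_of_apply_lt hci hi.le)
    (hv.contDiffAt _ hI hJ) (hv.harmonic _ hI hJ)).sub (hv.hasLaplacianAt hi hj)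

/-- Inversion preserves `{z j = 0}` because `c j = 0`, and it scales normal vectors there by `μ / ‖z
- c‖ ^ 2`; this is the extra power in `m + 1`. -/
lemma hasDerivWithinAt_kelvinTransform_line (hv : IsQuarterSolution i j p v)
    (hcj : c j = 0) (hci : c i < 0) (hi : 0 < z i) (hj : z j = 0)
    (hz : ‖z - c‖ ^ 2 ≤ μ) :
    HasDerivWithinAt (fun s : ℝ => kelvinTransform m v c μ
      (z + s • EuclideanSpace.single j (1 : ℝ)))
      (-((μ / ‖z - c‖ ^ 2) ^ (m + 1) * v (sphereInversion c μ z) ^ p)) (Ici 0) 0 := by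
  set e : EuclideanSpace ℝ ι := EuclideanSpace.single j 1 with he
  have hρ := norm_sub_sq_pos hci hi.le
  have hμ : 0 < μ := hρ.trans_le hz
  have hI := hi.trans_le (apply_le_sphereInversion_apply hci hi.le hz)
  have hJ : sphereInversion c μ z j = 0 := by simp [hcj, hj]
  obtain ⟨D, hD, hDe⟩ := hv.neumann _ hI hJ
  rw [← he] at hDe
  have hz0 : z + (0 : ℝ) • e = z := by simp
  have hρ' : 0 < ‖z + (0 : ℝ) • e - c‖ ^ 2 := by rwa [hz0]
  have h1 := hasDerivAt_sphereInversion_line μ z c j hρ'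
  rw [← he] at h1
  have h2 := (hasDerivAt_div_rpow m hμ hρ').comp (0 : ℝ)
    (hasDerivAt_norm_add_smul_single_sub_sq z c j 0)
  have hev : ∀ᶠ s in 𝓝[Ici 0] (0 : ℝ), sphereInversion c μ (z + s • e) ∈
      {x : EuclideanSpace ℝ ι | 0 ≤ x i ∧ 0 ≤ x j} := by
    have hcont := h1.continuousAt.tendsto
    rw [hz0] at hcont
    have hci : Continuous fun z : EuclideanSpace ℝ ι => z i := by fun_prop
    have h3 := hcont.eventually ((hci.tendsto (sphereInversion c μ z)).eventually_const_lt hI)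
    filter_upwards [nhdsWithin_le_nhds h3, self_mem_nhdsWithin] with s hs hs0
    have hs0' : (0 : ℝ) ≤ s := hs0
    refine ⟨hs.le, ?_⟩
    rw [sphereInversion_apply, hcj]
    simp only [he, PiLp.add_apply, hj, PiLp.smul_apply, PiLp.single_apply, if_true,
      smul_eq_mul, zero_add, sub_zero, mul_one]
    positivity
  have h4 : HasFDerivWithinAt v D {x | 0 ≤ x i ∧ 0 ≤ x j}
      (sphereInversion c μ (z + (0 : ℝ) • e)) := by rwa [hz0]
  have h5 := (h4.comp_hasDerivWithinAt (0 : ℝ) h1.hasDerivWithinAt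
    (mapsTo_preimage _ _)).mono_of_mem_nhdsWithin hev
  refine (h2.hasDerivWithinAt.mul h5).congr_deriv ?_
  simp only [hz0, hcj, hj, map_add, map_smul, hDe, Function.comp_apply]
  rw [Real.rpow_add_one (by positivity)]
  simp
  ring

/-- The only use of subcriticality: inside the sphere the ratio `μ / ‖z - c‖ ^ 2` is at least `1`,
so a larger exponent gives a larger power. -/
lemma kelvinTransform_rpow_le (hv : IsQuarterSolution i j p v) (hmp : m * p ≤ m + 1)
    (hρ : 0 < ‖z - c‖ ^ 2) (hz : ‖z - c‖ ^ 2 ≤ μ) :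
    kelvinTransform m v c μ z ^ p ≤
      (μ / ‖z - c‖ ^ 2) ^ (m + 1) * v (sphereInversion c μ z) ^ p := by
  have hq : 1 ≤ μ / ‖z - c‖ ^ 2 := by rwa [one_le_div hρ]
  have hq0 : 0 ≤ μ / ‖z - c‖ ^ 2 := by linarith
  rw [kelvinTransform, Real.mul_rpow (Real.rpow_nonneg hq0 m) (hv.nonneg _),
    ← Real.rpow_mul hq0]
  exact mul_le_mul_of_nonneg_right (Real.rpow_le_rpow_of_exponent_le hq hmp)
    (Real.rpow_nonneg (hv.nonneg _) p)

lemma exists_hasDerivWithinAt_kelvinTransform_sub (hv : IsQuarterSolution i j p v) (hij : i ≠ j)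
    (hmp : m * p ≤ m + 1) (hcj : c j = 0) (hci : c i < 0) (hi : 0 < z i) (hj : z j = 0)
    (hz : ‖z - c‖ ^ 2 ≤ μ) :
    ∃ d ≤ v z ^ p - kelvinTransform m v c μ z ^ p, HasDerivWithinAt
      (fun s : ℝ => kelvinTransform m v c μ (z + s • EuclideanSpace.single j (1 : ℝ))
        - v (z + s • EuclideanSpace.single j (1 : ℝ))) d (Ici 0) 0 := by
  refine ⟨_, ?_, (hv.hasDerivWithinAt_kelvinTransform_line hcj hci hi hj hz).sub
    (hv.hasDerivWithinAt_line hij hi hj)⟩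
  have := hv.kelvinTransform_rpow_le hmp (norm_sub_sq_pos hci hi.le) hz
  linarith

lemma continuousAt_kelvinTransform_sub (hv : IsQuarterSolution i j p v) (hm0 : 0 ≤ m)
    (hci : c i < 0) (hi : 0 ≤ z i) :
    ContinuousAt (fun x => kelvinTransform m v c μ x - v x) z :=
  ((continuousAt_kelvinTransform hv.continuous hm0 (ne_of_apply_lt hci hi) μ).comp
    (by fun_prop : ContinuousAt (fun x : EuclideanSpace ℝ ι => (μ, x)) z)).sub
    hv.continuous.continuousAt

/-- If `v` lies below its Kelvin transform in a cap, it does so strictly. -/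
lemma lt_kelvinTransform_of_le (hv : IsQuarterSolution i j p v) (hij : i ≠ j) (hp : 1 ≤ p)
    (hm0 : 0 ≤ m) (hm : 2 * m + 2 = Fintype.card ι) (hmp : m * p ≤ m + 1) (hcj : c j = 0)
    (hci : c i < 0)
    (hle : ∀ z : EuclideanSpace ℝ ι, 0 ≤ z i → 0 ≤ z j → ‖z - c‖ ^ 2 < μ →
      v z ≤ kelvinTransform m v c μ z)
    (hi : 0 ≤ z i) (hj : 0 ≤ z j) (hz : ‖z - c‖ ^ 2 < μ) :
    v z < kelvinTransform m v c μ z := by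
  have hface : ∀ z : EuclideanSpace ℝ ι, z i = 0 → 0 ≤ z j → ‖z - c‖ ^ 2 < μ →
      v z < kelvinTransform m v c μ z := by
    intro z hi hj hz
    have hρ := norm_sub_sq_pos hci hi.ge
    have hq : 1 < μ / ‖z - c‖ ^ 2 := by rwa [one_lt_div hρ]
    rw [hv.dirichlet z hi]
    refine mul_pos (Real.rpow_pos_of_pos (by linarith) m) (hv.pos_of_nonneg hij ?_ ?_)
    · rw [sphereInversion_apply, hi]
      nlinarith
    · rw [sphereInversion_apply, hcj]
      simp only [zero_add, sub_zero]
      exact mul_nonneg (by linarith) hj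
  have hcoord : ∀ k, Continuous fun z : EuclideanSpace ℝ ι => z k := fun k => by fun_prop
  have hO : IsOpen {x : EuclideanSpace ℝ ι | 0 < x i ∧ ‖x - c‖ ^ 2 < μ} :=
    (isOpen_lt continuous_const (hcoord i)).inter
      (isOpen_lt (by fun_prop : Continuous fun x : EuclideanSpace ℝ ι => ‖x - c‖ ^ 2)
        continuous_const)
  have hint : ∀ z : EuclideanSpace ℝ ι, 0 < z i → 0 < z j → ‖z - c‖ ^ 2 < μ →
      0 < kelvinTransform m v c μ z - v z := by
    intro z hi hj hz
    refine pos_of_harmonic_of_convex (j := j)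
      (w := fun x => kelvinTransform m v c μ x - v x)
      (C := {x | 0 < x i ∧ ‖x - c‖ ^ 2 < μ} ∩ {x | 0 < x j})
      (hO.inter (isOpen_lt continuous_const (hcoord j))) ?_ (fun z hz => hz.2)
      (fun z hz => (hv.continuousAt_kelvinTransform_sub hm0 hci hz.1.1.le).continuousWithinAt)
      (fun z hz => sub_nonneg.2 (hle z hz.1.1.le (le_of_lt hz.2) hz.1.2))
      (fun z hz => hv.hasLaplacianAt_kelvinTransform_sub hm hcj hci hz.1.1 hz.2 hz.1.2.le) ?_ z
      ⟨⟨hi, hz⟩, hj⟩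
    · have h1 : {x : EuclideanSpace ℝ ι | ‖x - c‖ ^ 2 < μ} = Metric.ball c (√μ) := by
        ext x
        rw [Metric.mem_ball, dist_eq_norm, mem_ofPred_eq, Real.lt_sqrt (norm_nonneg _)]
      have h2 : ∀ k, Convex ℝ {x : EuclideanSpace ℝ ι | 0 < x k} := fun k =>
        convex_halfSpace_gt ⟨fun _ _ => rfl, fun _ _ => rfl⟩ 0
      have h3 : Convex ℝ {x : EuclideanSpace ℝ ι | ‖x - c‖ ^ 2 < μ} := by
        rw [h1]
        exact convex_ball c _
      exact ((h2 i).inter h3).inter (h2 j)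
    -- A point of strict inequality is found near the projection `z₀` of `z` to `{z i = 0}`, where
    -- `hface` applies; `z₀` is still in the cap since `c i < 0`.
    · set e : EuclideanSpace ℝ ι := EuclideanSpace.single i 1 with he
      set z₀ := z + (-z i) • e with hz₀
      have hz₀i : z₀ i = 0 := by simp [hz₀, he]
      have hz₀j : z₀ j = z j := by simp [hz₀, he, hij.symm]
      have hz₀c : ‖z₀ - c‖ ^ 2 < μ := by
        rw [hz₀, he, norm_add_smul_single_sub_sq]
        nlinarith
      have hev : ∀ᶠ x in 𝓝 z₀, ‖x - c‖ ^ 2 < μ ∧ 0 < x j ∧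
          0 < kelvinTransform m v c μ x - v x := by
        have h1 : Continuous fun x : EuclideanSpace ℝ ι => ‖x - c‖ ^ 2 := by fun_prop
        refine ((h1.tendsto z₀).eventually_lt_const hz₀c).and
          ((((hcoord j).tendsto z₀).eventually_const_lt (by rwa [hz₀j])).and ?_)
        exact (hv.continuousAt_kelvinTransform_sub hm0 hci hz₀i.ge).tendsto.eventually_const_lt
          (sub_pos.2 (hface z₀ hz₀i (by rw [hz₀j]; exact hj.le) hz₀c))
      have hev' := (tendsto_add_smul_nhds_zero z₀ e).eventually hev
      obtain ⟨s, hs, hs0⟩ := ((hev'.filter_mono nhdsWithin_le_nhds).and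
        (self_mem_nhdsWithin (s := Ioi (0 : ℝ)))).exists
      refine ⟨z₀ + s • e, ⟨⟨?_, hs.1⟩, hs.2.1⟩, hs.2.2⟩
      have hs0' : (0 : ℝ) < s := hs0
      simpa [hz₀i, he] using hs0'
  rcases hi.eq_or_lt with hi | hi
  · exact hface z hi.symm hj hz
  rcases hj.eq_or_lt with hj | hj
  · refine sub_pos.1 (pos_on_flat_boundary (j := j)
      (w := fun x => kelvinTransform m v c μ x - v x) hO
      (fun z hz => (hv.continuousAt_kelvinTransform_sub hm0 hci hz.1.le).continuousWithinAt)
      (fun z hz hj => sub_nonneg.2 (hle z hz.1.le hj hz.2)) (fun z hz hj => hint z hz.1 hj hz.2)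
      (fun z hz hj => hv.hasLaplacianAt_kelvinTransform_sub hm hcj hci hz.1 hj hz.2.le)
      (fun z hz hj => ?_) z ⟨hi, hz⟩ hj.symm)
    obtain ⟨d, hd, h⟩ := hv.exists_hasDerivWithinAt_kelvinTransform_sub hij hmp hcj hci hz.1 hj
      hz.2.le
    refine ⟨d, hd.trans (sub_nonpos.2 ?_), h⟩
    exact Real.rpow_le_rpow (hv.nonneg z) (hle z hz.1.le hj.ge hz.2) (by linarith)
  · exact sub_pos.1 (hint z hi hj hz)

end IsQuarterSolution

end QuarterSolutions

/-! ### Moving spheres and the resulting monotonicity -/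

section Monotonicity

variable {ι : Type*} [Fintype ι] [DecidableEq ι]

namespace IsQuarterSolution

variable {i j : ι} {p m : ℝ} {v : EuclideanSpace ℝ ι → ℝ} {c z : EuclideanSpace ℝ ι} {μ : ℝ}

/-- The moving sphere method: `v` lies below its Kelvin transforms in all bounded caps cut off by
spheres centred on `{z i < 0, z j = 0}`. -/
lemma le_kelvinTransform (hv : IsQuarterSolution i j p v) (hij : i ≠ j) (hp : 1 ≤ p)
    (hm0 : 0 ≤ m) (hm : 2 * m + 2 = Fintype.card ι) (hmp : m * p ≤ m + 1) (hcj : c j = 0)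
    (hci : c i < 0) (hi : 0 ≤ z i) (hj : 0 ≤ z j) (hz : ‖z - c‖ ^ 2 < μ) :
    v z ≤ kelvinTransform m v c μ z := by
  have hcap : ∀ x : EuclideanSpace ℝ ι, 0 ≤ x i → c i ^ 2 ≤ ‖x - c‖ ^ 2 := fun x hx => by
    have := sq_le_norm_sub_sq x c i
    nlinarith
  set s : Set ℝ := {μ | ∀ z : EuclideanSpace ℝ ι, 0 ≤ z i → 0 ≤ z j → ‖z - c‖ ^ 2 < μ →
    v z ≤ kelvinTransform m v c μ z} with hs
  suffices h : Icc (c i ^ 2) μ ⊆ s from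
    h ⟨(hcap z hi).trans hz.le, le_rfl⟩ z hi hj hz
  -- Bounding `v` on the largest cap gives one Robin constant `K` for all smaller ones.
  obtain ⟨M, hM⟩ := (isCompact_quarterShell i j c 0 μ).bddAbove_image hv.continuous.continuousOn
  have hM : ∀ x : EuclideanSpace ℝ ι, 0 ≤ x i → 0 ≤ x j → ‖x - c‖ ^ 2 ≤ μ → v x ≤ max M 0 :=
    fun x h1 h2 h3 => (hM ⟨x, ⟨h1, h2, by positivity, h3⟩, rfl⟩).trans (le_max_left _ _)
  refine IsClosed.Icc_subset_of_forall_exists_gt ?_ ?_ ?_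
  · refine IsClosed.inter ?_ isClosed_Icc
    have : s = ⋂ (z : EuclideanSpace ℝ ι) (_ : 0 ≤ z i) (_ : 0 ≤ z j),
        ({μ | μ ≤ ‖z - c‖ ^ 2} ∪ {μ | v z ≤ kelvinTransform m v c μ z}) := by
      ext μ
      simp only [hs, mem_ofPred_eq, mem_iInter, mem_union, ← not_lt, ← imp_iff_not_or]
    rw [this]
    refine isClosed_iInter fun z => isClosed_iInter fun _ => isClosed_iInter fun _ =>
      (isClosed_le continuous_id continuous_const).union (isClosed_le continuous_const ?_)
    have h1 : Continuous fun μ : ℝ => μ / ‖z - c‖ ^ 2 := by fun_prop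
    exact (h1.rpow_const fun _ => Or.inr hm0).mul (hv.continuous.comp
      (continuous_const.add (h1.smul continuous_const)))
  -- At squared radius `c i ^ 2` the cap is empty.
  · exact fun x hx _ h => absurd h (not_lt.2 (hcap x hx))
  rintro μ₀ ⟨hμ₀s, hμ₀1, hμ₀2⟩ y hy
  have hy : μ₀ < y := hy
  set K := p * max M 0 ^ (p - 1) with hK
  have hK0 : 0 ≤ K := mul_nonneg (by linarith) (Real.rpow_nonneg (le_max_right _ _) _)
  have hμ₀ : 0 < μ₀ := (sq_pos_of_ne_zero hci.ne).trans_le hμ₀1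
  -- The radius `r` is so close to `√μ₀` that the outer shell is thin enough for the minimum
  -- principle. The rest of the cap is compact, and there strict inequality survives a small
  -- increase of `μ₀`.
  obtain ⟨r, ⟨hr0, hr1⟩, hr2⟩ : ∃ r, (0 < r ∧ (K + 1) * (μ₀ - r ^ 2) - r < 0) ∧ r < √μ₀ := by
    have hcont : Continuous fun r => (K + 1) * (μ₀ - r ^ 2) - r := by fun_prop
    have hsq : 0 < √μ₀ := Real.sqrt_pos.2 hμ₀
    have h1 : ∀ᶠ r in 𝓝 (√μ₀), 0 < r ∧ (K + 1) * (μ₀ - r ^ 2) - r < 0 := by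
      refine (eventually_gt_nhds hsq).and ((hcont.tendsto (√μ₀)).eventually_lt_const ?_)
      simp [Real.sq_sqrt hμ₀.le, hsq]
    exact ((h1.filter_mono nhdsWithin_le_nhds).and
      (self_mem_nhdsWithin (s := Iio (√μ₀)))).exists
  have hrμ : r ^ 2 < μ₀ := (Real.lt_sqrt hr0.le).1 hr2
  have htube : ∀ᶠ μ' in 𝓝 μ₀, ∀ z ∈ quarterShell i j c 0 (r ^ 2),
      0 < kelvinTransform m v c μ' z - v z := by
    refine (isCompact_quarterShell i j c 0 (r ^ 2)).eventually_forall_of_forall_eventually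
      (P := fun μ' z => 0 < kelvinTransform m v c μ' z - v z)
      fun z hz => ?_
    have h1 := (continuousAt_kelvinTransform hv.continuous hm0 (ne_of_apply_lt hci hz.1) μ₀).sub
      (hv.continuous.continuousAt.comp continuousAt_snd)
    exact h1.tendsto.eventually_const_lt (sub_pos.2 (hv.lt_kelvinTransform_of_le hij hp hm0 hm hmp
      hcj hci hμ₀s hz.1 hz.2.1 (hz.2.2.2.trans_lt hrμ)))
  have hthin : ∀ᶠ μ' in 𝓝 μ₀, (K + 1) * (μ' - r ^ 2) - r < 0 := by
    have hcont : Continuous fun μ' => (K + 1) * (μ' - r ^ 2) - r := by fun_prop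
    exact (hcont.tendsto μ₀).eventually_lt_const hr1
  obtain ⟨μ', ⟨h1, h2, h3, h4⟩, h5⟩ := (((htube.and (hthin.and ((eventually_lt_nhds hy).and
    (eventually_lt_nhds hμ₀2)))).filter_mono nhdsWithin_le_nhds).and
      (self_mem_nhdsWithin (s := Ioi μ₀))).exists
  have h5 : μ₀ < μ' := h5
  refine ⟨μ', fun z hi hj hz => ?_, h5, h3.le⟩
  rcases le_or_gt (‖z - c‖ ^ 2) (r ^ 2) with hzr | hzr
  · exact (sub_pos.1 (h1 z ⟨hi, hj, by positivity, hzr⟩)).le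
  refine sub_nonneg.1 (nonneg_on_thin_quarterShell hij hcj hK0 hr0 (by linarith)
    (w := fun x => kelvinTransform m v c μ' x - v x)
    (fun z hz => (hv.continuousAt_kelvinTransform_sub hm0 hci hz.1).continuousWithinAt) ?_
    (fun z hz hi hj => hv.hasLaplacianAt_kelvinTransform_sub hm hcj hci hi hj hz.2.2.2) ?_ z
    ⟨hi, hj, hzr.le, hz.le⟩)
  · rintro z hz (h | h | h)
    · rw [hv.dirichlet z h, sub_zero]
      exact hv.kelvinTransform_nonneg (hμ₀.trans h5).le
    · exact (h1 z ⟨hz.1, hz.2.1, by positivity, h.le⟩).le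
    · rw [kelvinTransform_of_norm_sq_eq m v (hμ₀.trans h5).ne' h, sub_self]
  · intro z hz hi hj hneg
    obtain ⟨d, hd, h⟩ := hv.exists_hasDerivWithinAt_kelvinTransform_sub hij hmp hcj hci hi hj
      hz.2.2.2
    refine ⟨d, hd.trans ?_, h⟩
    have := rpow_sub_rpow_le hp (hv.kelvinTransform_nonneg (hμ₀.trans h5).le)
      (sub_neg.1 hneg) (hM z hi.le hj.ge (hz.2.2.2.trans h4.le))
    linarith

/-- Inversion in a huge sphere with remote centre is nearly a reflection, and the radius is chosen
so that `z` goes almost to `z + d`; the error and the weight disappear as `ε → 0`. -/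
lemma le_add_of_pos (hv : IsQuarterSolution i j p v) (hij : i ≠ j) (hp : 1 ≤ p)
    (hm0 : 0 ≤ m) (hm : 2 * m + 2 = Fintype.card ι) (hmp : m * p ≤ m + 1) (hi : 0 ≤ z i)
    (hj : 0 ≤ z j) {d : EuclideanSpace ℝ ι} (hdi : 0 < d i) (hdj : d j = 0) :
    v z ≤ v (z + d) := by
  set e : EuclideanSpace ℝ ι := EuclideanSpace.single j 1 with he
  have hcont : Continuous fun ε : ℝ => (1 + ε) ^ m * v (z + d + (ε * z j) • e) :=
    ((by fun_prop : Continuous fun ε : ℝ => 1 + ε).rpow_const fun _ => Or.inr hm0).mul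
      (hv.continuous.comp (by fun_prop))
  have hlim : Tendsto (fun ε : ℝ => (1 + ε) ^ m * v (z + d + (ε * z j) • e)) (𝓝[>] 0)
      (𝓝 (v (z + d))) := by
    have := hcont.tendsto 0
    simp only [add_zero, Real.one_rpow, one_mul, zero_mul, zero_smul] at this
    exact this.mono_left nhdsWithin_le_nhds
  refine ge_of_tendsto hlim ?_
  have hsmall : ∀ᶠ ε in 𝓝 (0 : ℝ), ε * z i < d i := by
    have : Continuous fun ε : ℝ => ε * z i := by fun_prop
    exact (this.tendsto 0).eventually_lt_const (by simpa using hdi)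
  filter_upwards [hsmall.filter_mono nhdsWithin_le_nhds, self_mem_nhdsWithin] with ε hε hε0
  have hε0 : (0 : ℝ) < ε := hε0
  -- With squared radius `(1 + ε) * ‖z - c‖ ^ 2` the image of `z` is `z + ε • (z - c) = z + d + (ε *
  -- z j) • e`.
  set c := z - z j • e - ε⁻¹ • d with hc
  have hcj : c j = 0 := by simp [hc, he, hdj]
  have hci : c i < 0 := by
    have h1 : c i = z i - ε⁻¹ * d i := by simp [hc, he, hij]
    have h2 : ε⁻¹ * (ε * z i) < ε⁻¹ * d i := by gcongr
    rw [inv_mul_cancel_left₀ hε0.ne'] at h2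
    linarith
  have hρ := norm_sub_sq_pos hci hi
  have h1 := hv.le_kelvinTransform hij hp hm0 hm hmp hcj hci hi hj
    (show ‖z - c‖ ^ 2 < (1 + ε) * ‖z - c‖ ^ 2 by nlinarith)
  have h2 : (1 + ε) * ‖z - c‖ ^ 2 / ‖z - c‖ ^ 2 = 1 + ε :=
    mul_div_cancel_right₀ _ hρ.ne'
  have h3 : sphereInversion c ((1 + ε) * ‖z - c‖ ^ 2) z = z + d + (ε * z j) • e := by
    rw [sphereInversion, h2, hc]
    ext k
    simp
    field_simp
    ring
  rwa [kelvinTransform, h2, h3] at h1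

/-- `v` is nondecreasing in the coordinate `z i` and depends only on `z i` and `z j`. -/
lemma le_of_apply_le (hv : IsQuarterSolution i j p v) (hij : i ≠ j) (hp : 1 ≤ p)
    (hm0 : 0 ≤ m) (hm : 2 * m + 2 = Fintype.card ι) (hmp : m * p ≤ m + 1)
    {x : EuclideanSpace ℝ ι} (hi : 0 ≤ z i) (hj : 0 ≤ z j) (hix : z i ≤ x i) (hjx : z j = x j) :
    v z ≤ v x := by
  set e : EuclideanSpace ℝ ι := EuclideanSpace.single i 1 with he
  have hlim : Tendsto (fun ε : ℝ => v (x + ε • e)) (𝓝[>] 0) (𝓝 (v x)) :=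
    ((hv.continuous.tendsto x).comp (tendsto_add_smul_nhds_zero x e)).mono_left nhdsWithin_le_nhds
  refine ge_of_tendsto hlim ?_
  filter_upwards [self_mem_nhdsWithin] with ε hε
  have hε : (0 : ℝ) < ε := hε
  -- The shift by `ε` makes the `i`-component positive; the components other than `i` and `j` are
  -- arbitrary, so in the limit they do not matter.
  have := hv.le_add_of_pos hij hp hm0 hm hmp hi hj (d := x + ε • e - z)
    (by simp [he]; linarith) (by simp [he, hij.symm, hjx])
  simpa using this

end IsQuarterSolution

end Monotonicity

/-! ### Barrier on a large box -/

section Nonexistence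

variable {ι : Type*} [Fintype ι] [DecidableEq ι]

/-- A function on `[1, 1 + 2 * L] × [0, L / 4]` which is subharmonic inside where it is positive,
vanishes on all sides but `y = 0`, and satisfies a Robin condition with constant `8 / L` there. -/
noncomputable def boxBarrier (L x y : ℝ) : ℝ :=
  (1 - ((x - (1 + L)) / L) ^ 2) ^ 2 * (1 - 4 / L * y) ^ 2

lemma hasSecondDerivAtZero_boxBarrier_fst (L x y : ℝ) :
    HasSecondDerivAtZero (fun s => boxBarrier L (x + s) y)
      ((12 * ((x - (1 + L)) / L) ^ 2 - 4) / L ^ 2 * (1 - 4 / L * y) ^ 2) := by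
  set b := (1 - 4 / L * y) ^ 2
  set X : ℝ → ℝ := fun s => (x + s - (1 + L)) / L with hX
  have hXd : ∀ s, HasDerivAt X (1 / L) s := fun s =>
    (((hasDerivAt_id s).const_add x).sub_const (1 + L)).div_const L
  have hsq : ∀ s, HasDerivAt (fun s => 1 - X s ^ 2) (-(2 * X s / L)) s := fun s =>
    (((hXd s).fun_pow 2).const_sub 1).congr_deriv (by simp; ring)
  refine ⟨fun s => -(4 / L) * ((1 - X s ^ 2) * X s) * b, Eventually.of_forall fun s => ?_, ?_⟩
  · exact (((hsq s).fun_pow 2).mul_const b).congr_deriv (by push_cast; ring)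
  · refine ((((hsq 0).fun_mul (hXd 0)).const_mul (-(4 / L))).mul_const b).congr_deriv ?_
    simp [hX]
    ring

lemma hasDerivAt_boxBarrier_snd (L x y s : ℝ) :
    HasDerivAt (fun s => boxBarrier L x (y + s))
      (-(8 / L) * (1 - ((x - (1 + L)) / L) ^ 2) ^ 2 * (1 - 4 / L * (y + s))) s := by
  have h := ((((hasDerivAt_id s).const_add y).const_mul (4 / L)).const_sub 1).fun_pow 2
  exact (h.const_mul ((1 - ((x - (1 + L)) / L) ^ 2) ^ 2)).congr_deriv (by simp; ring)

lemma hasSecondDerivAtZero_boxBarrier_snd (L x y : ℝ) :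
    HasSecondDerivAtZero (fun s => boxBarrier L x (y + s))
      (32 / L ^ 2 * (1 - ((x - (1 + L)) / L) ^ 2) ^ 2) := by
  refine ⟨_, Eventually.of_forall (hasDerivAt_boxBarrier_snd L x y), ?_⟩
  have h := (((hasDerivAt_id (0 : ℝ)).const_add y).const_mul (4 / L)).const_sub 1
  exact (h.const_mul (-(8 / L) * (1 - ((x - (1 + L)) / L) ^ 2) ^ 2)).congr_deriv (by simp; ring)

/-- With `X = (x - (1 + L)) / L`, only `X ^ 2 < 1 / 3` makes the first term negative. It is then at
least `-4 / L ^ 2`, while the second exceeds `14 / L ^ 2`. -/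
lemma boxBarrier_laplacian_pos {L x y : ℝ} (hL : 0 < L) (hx : 0 < 1 - ((x - (1 + L)) / L) ^ 2)
    (hy0 : 0 ≤ y) (hy : y ≤ L / 4) :
    0 < (12 * ((x - (1 + L)) / L) ^ 2 - 4) / L ^ 2 * (1 - 4 / L * y) ^ 2
      + 32 / L ^ 2 * (1 - ((x - (1 + L)) / L) ^ 2) ^ 2 := by
  set X := (x - (1 + L)) / L
  set b := (1 - 4 / L * y) ^ 2
  have h1 : 0 ≤ 4 / L * y := by positivity
  have h2 : 4 / L * y ≤ 1 := by
    rw [div_mul_eq_mul_div, div_le_one hL]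
    linarith
  have hb : b ≤ 1 := by
    simp only [b]
    nlinarith
  have hb0 : 0 ≤ b := sq_nonneg _
  have key : 0 < (12 * X ^ 2 - 4) * b + 32 * (1 - X ^ 2) ^ 2 := by
    rcases le_or_gt (1 / 3) (X ^ 2) with h | h
    · have h3 : 0 ≤ (12 * X ^ 2 - 4) * b := mul_nonneg (by linarith) hb0
      positivity
    · have h3 : (4 - 12 * X ^ 2) * b ≤ (4 - 12 * X ^ 2) * 1 :=
        mul_le_mul_of_nonneg_left hb (by linarith)
      nlinarith [sq_nonneg X]
  have : (12 * X ^ 2 - 4) / L ^ 2 * b + 32 / L ^ 2 * (1 - X ^ 2) ^ 2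
      = ((12 * X ^ 2 - 4) * b + 32 * (1 - X ^ 2) ^ 2) / L ^ 2 := by ring
  rw [this]
  positivity

/-- There is no solution which is nondecreasing in `z i` and depends only on `z i` and `z j`. -/
lemma IsQuarterSolution.false_of_monotone {i j : ι} {p : ℝ} {v : EuclideanSpace ℝ ι → ℝ}
    (hv : IsQuarterSolution i j p v) (hij : i ≠ j) (hp : 1 ≤ p)
    (hmono : ∀ z x : EuclideanSpace ℝ ι, 0 ≤ z i → 0 ≤ z j → z i ≤ x i → z j = x j → v z ≤ v x) :
    False := by
  set P : ℝ × ℝ → EuclideanSpace ℝ ι := fun t =>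
    t.1 • EuclideanSpace.single i (1 : ℝ) + t.2 • EuclideanSpace.single j (1 : ℝ) with hP
  have hPi : ∀ t, P t i = t.1 := fun t => by simp [hP, hij]
  have hPj : ∀ t, P t j = t.2 := fun t => by simp [hP, hij.symm]
  have hPc : Continuous P := by fun_prop
  have hv₁ : 0 < v (P (1, 0)) := hv.pos_of_nonneg hij (by simp [hPi]) (by simp [hPj])
  set κ := v (P (1, 0)) ^ (p - 1) with hκ
  have hκ0 : 0 < κ := Real.rpow_pos_of_pos hv₁ _
  -- Makes the Robin constant `8 / L` of the barrier equal to `κ / 2`, strictly below the rate `κ`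
  -- of `v`.
  set L := 16 / κ with hL
  have hL0 : 0 < L := by positivity
  set T : Set (ℝ × ℝ) := Icc 1 (1 + 2 * L) ×ˢ Icc 0 (L / 4) with hT
  have hvT : ∀ t ∈ T, 0 < v (P t) := fun t ht => hv.pos_of_nonneg hij
    (by rw [hPi]; linarith [ht.1.1]) (by rw [hPj]; exact ht.2.1)
  have hmem : ((1 + L, 0) : ℝ × ℝ) ∈ T :=
    ⟨⟨by linarith, by linarith⟩, ⟨le_rfl, by positivity⟩⟩
  have hFc : Continuous fun t : ℝ × ℝ => boxBarrier L t.1 t.2 := by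
    unfold boxBarrier
    fun_prop
  have hquot : ContinuousOn (fun t => boxBarrier L t.1 t.2 / v (P t)) T :=
    hFc.continuousOn.div (hv.continuous.comp hPc).continuousOn fun t ht => (hvT t ht).ne'
  obtain ⟨t, ht, hmax⟩ := (isCompact_Icc.prod isCompact_Icc : IsCompact T).exists_isMaxOn
    ⟨_, hmem⟩ hquot
  have hmax : ∀ x y, (x, y) ∈ T →
      boxBarrier L x y / v (P (x, y)) ≤ boxBarrier L t.1 t.2 / v (P t) :=
    fun x y h => isMaxOn_iff.1 hmax (x, y) h
  -- The least multiple of `v` lying above the barrier on the box; the two touch at `t`.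
  set σ := boxBarrier L t.1 t.2 / v (P t) with hσ
  have hσ0 : 0 < σ := by
    have h1 := hmax _ _ hmem
    have h2 : boxBarrier L (1 + L) 0 = 1 := by simp [boxBarrier]
    refine lt_of_lt_of_le (div_pos ?_ (hvT _ hmem)) h1
    simp [h2]
  have hvt := hvT t ht
  have hB0 : boxBarrier L t.1 t.2 = σ * v (P t) := by
    rw [hσ]
    field_simp
  have hBpos : 0 < boxBarrier L t.1 t.2 := by
    rw [hB0]
    positivity
  set ψ : EuclideanSpace ℝ ι → ℝ := fun z => σ * v z - boxBarrier L (z i) (z j) with hψ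
  have hψt : ψ (P t) = 0 := by simp only [hψ, hPi, hPj, hB0, sub_self]
  have hψnn : ∀ z : EuclideanSpace ℝ ι, (z i, z j) ∈ T → ψ (P t) ≤ ψ z := by
    intro z hz
    have h1 : boxBarrier L (z i) (z j) / v (P (z i, z j)) ≤ σ := hmax _ _ hz
    rw [div_le_iff₀ (hvT _ hz)] at h1
    -- This carries the two-variable comparison to all dimensions, so `P t` is a minimum of `ψ` in
    -- the remaining directions too.
    have h2 : v (P (z i, z j)) ≤ v z := hmono _ _ (by rw [hPi]; linarith [hz.1.1])
      (by rw [hPj]; exact hz.2.1) (by rw [hPi]) (by rw [hPj])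
    rw [hψt]
    simp only [hψ]
    nlinarith
  have hXpos : 0 < 1 - ((t.1 - (1 + L)) / L) ^ 2 := by
    have h1 : ((t.1 - (1 + L)) / L) ^ 2 ≤ 1 := by
      rw [sq_le_one_iff_abs_le_one, abs_le, le_div_iff₀ hL0, div_le_iff₀ hL0]
      constructor <;> linarith [ht.1.1, ht.1.2]
    refine lt_of_le_of_ne (by linarith) fun h => ?_
    rw [boxBarrier, ← h] at hBpos
    simp at hBpos
  have hx1 : 1 < t.1 := by
    refine lt_of_le_of_ne ht.1.1 fun h => ?_
    rw [← h] at hXpos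
    field_simp at hXpos
    simp at hXpos
  have hx2 : t.1 < 1 + 2 * L := by
    refine lt_of_le_of_ne ht.1.2 fun h => ?_
    have h1 : (t.1 - (1 + L)) / L = 1 := by
      rw [h]
      field_simp
      ring
    simp [h1] at hXpos
  have hy2 : t.2 < L / 4 := by
    refine lt_of_le_of_ne ht.2.2 fun h => ?_
    have h1 : 4 / L * t.2 = 1 := by
      rw [h]
      field_simp
    simp [boxBarrier, h1] at hBpos
  have hnhds : ∀ᶠ z in 𝓝 (P t), (1 < z i ∧ z i < 1 + 2 * L) ∧ z j < L / 4 := by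
    have hci : Continuous fun z : EuclideanSpace ℝ ι => z i := by fun_prop
    have hcj : Continuous fun z : EuclideanSpace ℝ ι => z j := by fun_prop
    exact (((hci.tendsto _).eventually_const_lt (by rwa [hPi])).and
      ((hci.tendsto _).eventually_lt_const (by rwa [hPi]))).and
      ((hcj.tendsto _).eventually_lt_const (by rwa [hPj]))
  have hit : 0 < P t i := by rw [hPi]; linarith
  rcases ht.2.1.eq_or_lt with hy | hy
  · have hjt : P t j = 0 := by rw [hPj, ← hy]
    have h1 := ((hv.hasDerivWithinAt_line hij hit hjt).const_mul σ).fun_sub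
      (hasDerivAt_boxBarrier_snd L t.1 0 0).hasDerivWithinAt
    have h2 := h1.nonneg_of_eventually_le (by
      have h5 := (tendsto_add_smul_nhds_zero (P t)
        (EuclideanSpace.single j (1 : ℝ))).eventually hnhds
      filter_upwards [h5.filter_mono nhdsWithin_le_nhds, self_mem_nhdsWithin] with s hs hs0
      have hs0 : (0 : ℝ) < s := hs0
      have := hψnn (P t + s • EuclideanSpace.single j (1 : ℝ))
        ⟨⟨hs.1.1.le, hs.1.2.le⟩, by simp [hjt, hs0.le], hs.2.le⟩
      simpa [hψ, hPi, hPj, hij, ← hy] using this)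
    have h3 : (1 - ((t.1 - (1 + L)) / L) ^ 2) ^ 2 = σ * v (P t) := by
      rw [← hB0, boxBarrier, ← hy]
      simp
    have h4 : v (P t) ^ p = v (P t) ^ (p - 1) * v (P t) := by
      rw [Real.rpow_sub_one hvt.ne']
      field_simp
    have h5 : κ ≤ v (P t) ^ (p - 1) :=
      Real.rpow_le_rpow hv₁.le (hmono _ _ (by simp [hPi]) (by simp [hPj])
        (by rw [hPi, hPi]; exact hx1.le) (by rw [hPj, hPj]; exact hy)) (by linarith)
    have h6 : 8 / L = κ / 2 := by
      rw [hL]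
      field_simp
      norm_num
    rw [h3, h4, h6] at h2
    have h7 : 0 < σ * v (P t) := by positivity
    have h8 : κ * (σ * v (P t)) ≤ v (P t) ^ (p - 1) * (σ * v (P t)) := by gcongr
    have h9 : 0 < κ * (σ * v (P t)) := by positivity
    nlinarith
  · have hlap := ((hv.hasLaplacianAt hit (by rwa [hPj])).const_mul σ).sub
      (hasLaplacianAt_two_coords (F := boxBarrier L) hij (P t)
        (hasSecondDerivAtZero_boxBarrier_fst L _ _) (hasSecondDerivAtZero_boxBarrier_snd L _ _))
    have hcj : Continuous fun z : EuclideanSpace ℝ ι => z j := by fun_prop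
    have h2 := hlap.nonneg_of_isLocalMin (by
      filter_upwards [hnhds, (hcj.tendsto _).eventually_const_lt (by rwa [hPj])] with z hz hzj
      exact hψnn z ⟨⟨hz.1.1.le, hz.1.2.le⟩, le_of_lt hzj, hz.2.le⟩)
    rw [hPi, hPj] at h2
    have := boxBarrier_laplacian_pos hL0 hXpos ht.2.1 ht.2.2
    linarith

end Nonexistence

/-! ### Extending a classical solution to the whole space -/

section QuarterSpace

variable {n : ℕ}

/-- Replaces the coordinates `x_n` and `y` by their positive parts. -/
noncomputable def quarterClamp (n : ℕ) (z : EuclideanSpace ℝ (Fin (n + 1))) :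
    EuclideanSpace ℝ (Fin (n + 1)) :=
  WithLp.toLp 2 fun k => if k = xIdx n ∨ k = yIdx n then max (z k) 0 else z k

lemma continuous_quarterClamp : Continuous (quarterClamp n) := by
  unfold quarterClamp
  refine (PiLp.continuous_toLp 2 _).comp (continuous_pi fun k => ?_)
  split_ifs <;> fun_prop

lemma isOpen_quarterSpace : IsOpen (quarterSpace n) := by
  have h : ∀ k, Continuous fun z : EuclideanSpace ℝ (Fin (n + 1)) => z k := fun k => by fun_prop
  exact (isOpen_lt continuous_const (h _)).inter (isOpen_lt continuous_const (h _))

lemma mem_closure_quarterSpace {z : EuclideanSpace ℝ (Fin (n + 1))} (hx : 0 ≤ z (xIdx n))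
    (hy : 0 ≤ z (yIdx n)) : z ∈ closure (quarterSpace n) := by
  refine mem_closure_of_tendsto ((tendsto_add_smul_nhds_zero z (WithLp.toLp 2 1)).mono_left
    nhdsWithin_le_nhds : Tendsto _ (𝓝[>] (0 : ℝ)) _) ?_
  filter_upwards [self_mem_nhdsWithin] with s hs
  have hs : (0 : ℝ) < s := hs
  constructor
  · simp
    linarith
  · simp
    linarith

lemma quarterClamp_of_nonneg {z : EuclideanSpace ℝ (Fin (n + 1))} (hx : 0 ≤ z (xIdx n))
    (hy : 0 ≤ z (yIdx n)) : quarterClamp n z = z := by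
  ext k
  simp only [quarterClamp]
  split_ifs with h
  · rcases h with rfl | rfl
    · exact max_eq_left hx
    · exact max_eq_left hy
  · rfl

lemma quarterClamp_mem_closure (z : EuclideanSpace ℝ (Fin (n + 1))) :
    quarterClamp n z ∈ closure (quarterSpace n) :=
  mem_closure_quarterSpace (by simp [quarterClamp]) (by simp [quarterClamp])

/-- Composing with the projection onto the closed quarter space leaves `u` unchanged there and gives
a globally continuous function, whatever values `u` takes outside. -/
lemma IsClassicalSolution.isQuarterSolution {p : ℝ} {u : EuclideanSpace ℝ (Fin (n + 1)) → ℝ}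
    (hu : IsClassicalSolution n p u) :
    IsQuarterSolution (xIdx n) (yIdx n) p fun z => u (quarterClamp n z) := by
  have heq : ∀ z : EuclideanSpace ℝ (Fin (n + 1)), 0 < z (xIdx n) → 0 < z (yIdx n) →
      (fun z => u (quarterClamp n z)) =ᶠ[𝓝 z] u := fun z hx hy => by
    filter_upwards [isOpen_quarterSpace.mem_nhds (show z ∈ quarterSpace n from ⟨hx, hy⟩)] with x h
    rw [quarterClamp_of_nonneg h.1.le h.2.le]
  refine ⟨hu.contDiffOn_one.continuousOn.comp_continuous continuous_quarterClamp
    quarterClamp_mem_closure, fun z => ?_, fun z hx hy => ?_, fun z hx hy => ?_,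
    fun z hx hy => ?_, fun z hx => ?_, fun z hx hy => ?_⟩
  · exact ContinuousWithinAt.closure_le (quarterClamp_mem_closure z) continuousWithinAt_const
      ((hu.contDiffOn_one.continuousOn _ (quarterClamp_mem_closure z)).mono subset_closure)
      fun y hy => (hu.pos y hy).le
  · rw [quarterClamp_of_nonneg hx.le hy.le]
    exact hu.pos z ⟨hx, hy⟩
  · exact (hu.contDiffOn_two.contDiffAt (isOpen_quarterSpace.mem_nhds
      ⟨hx, hy⟩)).congr_of_eventuallyEq (heq z hx hy)
  · rw [(InnerProductSpace.laplacian_congr_nhds (heq z hx hy)).self_of_nhds]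
    exact hu.harmonic z ⟨hx, hy⟩
  · exact hu.dirichlet _ (by simp [quarterClamp, hx]) (by simp [quarterClamp])
  · have hcl : z ∈ closure (quarterSpace n) := mem_closure_quarterSpace hx.le hy.ge
    have hz : quarterClamp n z = z := quarterClamp_of_nonneg hx.le hy.ge
    refine ⟨fderivWithin ℝ u (closure (quarterSpace n)) z, ?_, ?_⟩
    · have h1 : HasFDerivWithinAt u (fderivWithin ℝ u (closure (quarterSpace n)) z)
          {x | 0 ≤ x (xIdx n) ∧ 0 ≤ x (yIdx n)} z :=
        ((hu.contDiffOn_one z hcl).differentiableWithinAt (by simp)).hasFDerivWithinAt.mono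
          fun x hx => mem_closure_quarterSpace hx.1 hx.2
      exact h1.congr (fun x hx => by rw [quarterClamp_of_nonneg hx.1 hx.2]) (by rw [hz])
    · have h1 := hu.neumann z hx hy
      rw [outerNormal, map_neg] at h1
      rw [hz, ← h1, neg_neg]

end QuarterSpace

/-- Nonexistence of classical solutions, bounded or not, of the nonlinear boundary value problem
in the quarter space. -/
theorem theorem1p2 (n : ℕ) (hn : 1 ≤ n) (p : ℝ) (hp : 1 ≤ p)
    (hpn : 2 ≤ n → p ≤ ((n : ℝ) + 1) / ((n : ℝ) - 1)) :
    ¬ ∃ u : EuclideanSpace ℝ (Fin (n + 1)) → ℝ, IsClassicalSolution n p u := by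
  rintro ⟨u, hu⟩
  have hij : xIdx n ≠ yIdx n := by
    simp only [xIdx, yIdx, ne_eq, Fin.ext_iff, Fin.val_last]
    omega
  have hn' : (1 : ℝ) ≤ n := by exact_mod_cast hn
  have hm : 2 * (((n : ℝ) - 1) / 2) + 2 = Fintype.card (Fin (n + 1)) := by
    rw [Fintype.card_fin]
    push_cast
    ring
  have hmp : ((n : ℝ) - 1) / 2 * p ≤ ((n : ℝ) - 1) / 2 + 1 := by
    -- For `n = 1` the exponent `m` is `0`, so every `p` is subcritical.
    rcases hn.eq_or_lt with rfl | h
    · norm_num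
    · have h2 : (2 : ℝ) ≤ n := by exact_mod_cast h
      have := hpn h
      rw [le_div_iff₀ (by linarith)] at this
      linarith
  exact hu.isQuarterSolution.false_of_monotone hij hp fun z x =>
    hu.isQuarterSolution.le_of_apply_le hij hp (by linarith) hm hmp
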